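/- **Theorem 4.1.** Let $M$ be a surface of revolution in $\mathbb{E}^3$: in some Cartesian coordinate system it is parametrized by $$X(s,t)=(x(s)\cos t,\;x(s)\sin t,\;z(s)),\qquad s\in I,\ t\in\mathbb{R},$$ where $I$ is a nonempty open interval, $x,z:I\to\mathbb{R}$ are smooth, $x>0$, and $x'^2+z'^2=1$. Let $G$ be a Gauss map of $M$ (a continuous unit normal field along $X$), $S=-dG$ the shape operator with respect to $G$, and let $\square$ be the Cheng-Yau operator of $M$, $\square f=-\operatorname{tr}\bigl((\operatorname{tr}(S)I-S)\circ\nabla^2 f\bigr)$, where $\nabla^2 f$ is the self-adjoint operator metrically equivalent to the Hessian of $f$ for the induced metric; $\square$ acts on $G$ through its three Cartesian coordinates. Then there is a constant real $3\times 3$ matrix $A$ with $\square G=AG$ on $M$ if and only if $M=X(I\times\mathbb{R})$ is an open part (a relatively open subset) of a plane, a right circular cone, a circular cylinder or a sphere. -/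

import Mathlib

open scoped ContDiff Matrix

noncomputable section

/-- Euclidean 3-space. -/
abbrev E3 : Type := EuclideanSpace ℝ (Fin 3)

/-! ### Parametrized surfaces in Euclidean 3-space

A parametrized surface is a map `X` of two real parameters into `E3`, considered on a parameter
domain `U`. The tensors below are written in the coordinate frame `∂₀ X, ∂₁ X`. -/

/-- The `i`-th coordinate partial derivative of a function of two parameters. -/
def partialD {F : Type*} [NormedAddCommGroup F] [NormedSpace ℝ F]
    (i : Fin 2) (f : (Fin 2 → ℝ) → F) (q : Fin 2 → ℝ) : F :=
  fderiv ℝ f q (Pi.single i 1)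

/-- `G` is a Gauss map of the surface `X` on `U`: a continuous field of unit vectors normal to the
surface. (For a smooth immersion such a field is automatically smooth, and on a connected domain it
is unique up to sign.) -/
structure IsGaussMap (X : (Fin 2 → ℝ) → E3) (U : Set (Fin 2 → ℝ)) (G : (Fin 2 → ℝ) → E3) :
    Prop where
  continuousOn : ContinuousOn G U
  norm_eq_one : ∀ q ∈ U, ‖G q‖ = 1
  normal : ∀ q ∈ U, ∀ i, inner ℝ (G q) (partialD i X q) = 0

/-- The induced metric `g i j = ⟨∂ᵢ X, ∂ⱼ X⟩`. -/
def metric (X : (Fin 2 → ℝ) → E3) (q : Fin 2 → ℝ) : Matrix (Fin 2) (Fin 2) ℝ :=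
  Matrix.of fun i j => inner ℝ (partialD i X q) (partialD j X q)

/-- The second fundamental form with respect to `G`, `h i j = ⟨S (∂ⱼ X), ∂ᵢ X⟩` with `S = -dG`. -/
def secondForm (X G : (Fin 2 → ℝ) → E3) (q : Fin 2 → ℝ) : Matrix (Fin 2) (Fin 2) ℝ :=
  Matrix.of fun i j => -inner ℝ (partialD j G q) (partialD i X q)

/-- The matrix of the shape operator `S` with respect to `G`, in the coordinate frame. -/
def shapeOp (X G : (Fin 2 → ℝ) → E3) (q : Fin 2 → ℝ) : Matrix (Fin 2) (Fin 2) ℝ :=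
  (metric X q)⁻¹ * secondForm X G q

/-- Christoffel symbols of the Levi-Civita connection of the induced metric. -/
def christoffel (X : (Fin 2 → ℝ) → E3) (k i j : Fin 2) (q : Fin 2 → ℝ) : ℝ :=
  (1 / 2) * ∑ l, (metric X q)⁻¹ k l *
    (partialD i (fun p => metric X p j l) q + partialD j (fun p => metric X p i l) q
      - partialD l (fun p => metric X p i j) q)

/-- The covariant Hessian of a function, as a bilinear form:
`(∇² f) i j = ∂ᵢ ∂ⱼ f - ∑ₖ Γᵏᵢⱼ ∂ₖ f`. -/
def hessForm (X : (Fin 2 → ℝ) → E3) (f : (Fin 2 → ℝ) → ℝ) (q : Fin 2 → ℝ) :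
    Matrix (Fin 2) (Fin 2) ℝ :=
  Matrix.of fun i j =>
    partialD i (partialD j f) q - ∑ k, christoffel X k i j q * partialD k f q

/-- The matrix, in the coordinate frame, of the self-adjoint operator metrically equivalent to the
Hessian. -/
def hessOp (X : (Fin 2 → ℝ) → E3) (f : (Fin 2 → ℝ) → ℝ) (q : Fin 2 → ℝ) :
    Matrix (Fin 2) (Fin 2) ℝ :=
  (metric X q)⁻¹ * hessForm X f q

/-- The Cheng-Yau operator `□ f = -tr (P₁ ∘ ∇² f)` with `P₁ = tr(S) I - S`. -/
def chengYau (X G : (Fin 2 → ℝ) → E3) (f : (Fin 2 → ℝ) → ℝ) (q : Fin 2 → ℝ) : ℝ :=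
  -Matrix.trace (((shapeOp X G q).trace • (1 : Matrix (Fin 2) (Fin 2) ℝ) - shapeOp X G q)
    * hessOp X f q)

/-- `□ G`, where `□` acts on each Cartesian coordinate function of `G`. -/
def chengYauGauss (X G : (Fin 2 → ℝ) → E3) (q : Fin 2 → ℝ) : E3 :=
  WithLp.toLp 2 fun i => chengYau X G (fun p => G p i) q

/-! ### Surfaces of revolution -/

/-- A surface of revolution: the smooth unit speed curve `s ↦ (x s, 0, z s)`, `x > 0`, on an open
interval, in a Cartesian coordinate system of `E3` given by an origin and an orthonormal frame, is
rotated around the third axis of that system. -/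
structure SurfaceOfRevolution where
  origin : E3
  frame : OrthonormalBasis (Fin 3) ℝ E3
  interval : Set ℝ
  isOpen_interval : IsOpen interval
  isConnected_interval : IsConnected interval
  x : ℝ → ℝ
  z : ℝ → ℝ
  smooth_x : ContDiffOn ℝ ∞ x interval
  smooth_z : ContDiffOn ℝ ∞ z interval
  unit_speed : ∀ s ∈ interval, deriv x s ^ 2 + deriv z s ^ 2 = 1
  x_pos : ∀ s ∈ interval, 0 < x s

namespace SurfaceOfRevolution

/-- The parametrization `X(s, t) = (x s cos t, x s sin t, z s)`, with `s = q 0` and `t = q 1`. -/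
def param (M : SurfaceOfRevolution) (q : Fin 2 → ℝ) : E3 :=
  M.origin + (M.x (q 0) * Real.cos (q 1)) • M.frame 0 + (M.x (q 0) * Real.sin (q 1)) • M.frame 1
    + M.z (q 0) • M.frame 2

/-- The parameter domain: `s` in the interval, `t` arbitrary. -/
def domain (M : SurfaceOfRevolution) : Set (Fin 2 → ℝ) := {q | q 0 ∈ M.interval}

/-- The point set of the surface. -/
def carrier (M : SurfaceOfRevolution) : Set E3 := M.param '' M.domain

end SurfaceOfRevolution

/-! ### The model surfaces -/

/-- A plane, with unit normal `d`. -/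
def IsPlane (P : Set E3) : Prop :=
  ∃ (d : E3) (c : ℝ), ‖d‖ = 1 ∧ P = {y | inner ℝ y d = c}

/-- A right circular cone with apex `a`, axis direction `d` and half-angle `α`: the points `y` for
which `y - a` makes the angle `α` with `d`, together with the apex. -/
def IsRightCircularCone (P : Set E3) : Prop :=
  ∃ (a d : E3) (α : ℝ), ‖d‖ = 1 ∧ 0 < α ∧ α < Real.pi / 2 ∧
    P = {y | inner ℝ (y - a) d = ‖y - a‖ * Real.cos α}

/-- A circular cylinder: the points at distance `r > 0` from the line through `a` with
direction `d`. -/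
def IsCircularCylinder (P : Set E3) : Prop :=
  ∃ (a d : E3) (r : ℝ), ‖d‖ = 1 ∧ 0 < r ∧
    P = {y | ‖(y - a) - inner ℝ (y - a) d • d‖ = r}

/-- A round sphere of positive radius. -/
def IsRoundSphere (P : Set E3) : Prop :=
  ∃ (c : E3) (r : ℝ), 0 < r ∧ P = Metric.sphere c r

/-- `M` is an open part of `P`: a subset of `P` that is open in the relative topology of `P`. -/
def IsOpenPart (M P : Set E3) : Prop :=
  ∃ O : Set E3, IsOpen O ∧ M = P ∩ O

end

/-! Write k and w for the principal curvatures along meridians and parallels, K = k w, and (c, u) =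
(x', z') for the unit velocity of the profile. Since the metric and the second form are diagonal, a
direct computation gives □G = ∇K + (k + w) K G, a combination of the radial direction and the axis
(`chengYauGauss_param`, `radialCoeff_eq`, `axialCoeff_eq`).

If □G = AG, comparing opposite points of a parallel leaves only two diagonal entries of A in the
frame of the surface, up to sign: l (radial) and μ (axial). In the tangent and normal directions
this reads K' = (μ - l) c u and (k + w) K = μ c² + l u². The heart of the proof is
`curvature_mul_deriv_eq_zero`. Where K K' ≠ 0, differentiating and eliminating k' by means of the
Codazzi equation w' = (k - w) c / x leads to homogeneous polynomial relations between k and w. These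
have no common solution with w ≠ 0. Hence K² is constant. Either K = 0 and the profile is straight,
or K and, once μ = l, also k + w are constant; then k = w is constant and the profile is a circle
centred on the axis. Conversely □G = 0 for straight profiles, and □G is a constant multiple of G for
circular ones.

It remains to match profiles with model surfaces. A straight profile sweeps out part of a plane,
cone or cylinder, a circular one part of a sphere. In the other direction the position of the model
relative to the axis is unknown; restricting its equation to a parallel gives a polynomial vanishing
on a circle, whose coefficients locate the model (`axis_of_subset_quadric`). -/

noncomputable section

open Filter Topology

/-! ### Functions of the form cos t · a(s) + sin t · b(s) + c(s) -/

section Trig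

variable {F : Type*} [NormedAddCommGroup F] [NormedSpace ℝ F]

/-- The function `(s, t) ↦ cos t • a s + sin t • b s + c s`. -/
def trig (a b c : ℝ → F) (q : Fin 2 → ℝ) : F :=
  Real.cos (q 1) • a (q 0) + Real.sin (q 1) • b (q 0) + c (q 0)

theorem hasFDerivAt_trig {a b c : ℝ → F} {a' b' c' : F} {q : Fin 2 → ℝ}
    (ha : HasDerivAt a a' (q 0)) (hb : HasDerivAt b b' (q 0)) (hc : HasDerivAt c c' (q 0)) :
    HasFDerivAt (trig a b c)
      ((ContinuousLinearMap.proj (R := ℝ) (φ := fun _ : Fin 2 => ℝ) 0).smulRight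
          (Real.cos (q 1) • a' + Real.sin (q 1) • b' + c')
        + (ContinuousLinearMap.proj (R := ℝ) (φ := fun _ : Fin 2 => ℝ) 1).smulRight
          (Real.cos (q 1) • b (q 0) - Real.sin (q 1) • a (q 0))) q := by
  have h0 : HasFDerivAt (fun p : Fin 2 → ℝ => p 0)
      (ContinuousLinearMap.proj (R := ℝ) (φ := fun _ : Fin 2 => ℝ) 0) q :=
    hasFDerivAt_apply 0 q
  have h1 : HasFDerivAt (fun p : Fin 2 → ℝ => p 1)
      (ContinuousLinearMap.proj (R := ℝ) (φ := fun _ : Fin 2 => ℝ) 1) q :=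
    hasFDerivAt_apply 1 q
  have hcos := (Real.hasDerivAt_cos (q 1)).comp_hasFDerivAt q h1
  have hsin := (Real.hasDerivAt_sin (q 1)).comp_hasFDerivAt q h1
  have h := ((hcos.smul (ha.hasFDerivAt.comp q h0)).add
    (hsin.smul (hb.hasFDerivAt.comp q h0))).add (hc.hasFDerivAt.comp q h0)
  refine h.congr_fderiv ?_
  ext v
  simp [smul_smul]
  module

theorem partialD_zero_trig {a b c : ℝ → F} {a' b' c' : F} {q : Fin 2 → ℝ}
    (ha : HasDerivAt a a' (q 0)) (hb : HasDerivAt b b' (q 0)) (hc : HasDerivAt c c' (q 0)) :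
    partialD 0 (trig a b c) q = Real.cos (q 1) • a' + Real.sin (q 1) • b' + c' := by
  simp [partialD, (hasFDerivAt_trig ha hb hc).fderiv]

theorem partialD_one_trig {a b c : ℝ → F} {a' b' c' : F} {q : Fin 2 → ℝ}
    (ha : HasDerivAt a a' (q 0)) (hb : HasDerivAt b b' (q 0)) (hc : HasDerivAt c c' (q 0)) :
    partialD 1 (trig a b c) q = Real.cos (q 1) • b (q 0) - Real.sin (q 1) • a (q 0) := by
  simp [partialD, (hasFDerivAt_trig ha hb hc).fderiv]

theorem partialD_congr {f g : (Fin 2 → ℝ) → F} {q : Fin 2 → ℝ} (i : Fin 2) (h : f =ᶠ[𝓝 q] g) :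
    partialD i f q = partialD i g q := by
  simp [partialD, h.fderiv_eq]

theorem partialD_of_comp_zero {f : (Fin 2 → ℝ) → F} {c : ℝ → F} {c' : F} {q : Fin 2 → ℝ}
    (h : f =ᶠ[𝓝 q] fun p => c (p 0)) (hc : HasDerivAt c c' (q 0)) :
    partialD 0 f q = c' ∧ partialD 1 f q = 0 := by
  have e : (fun p : Fin 2 → ℝ => c (p 0)) = trig (fun _ => (0 : F)) (fun _ => 0) c := by
    ext p; simp [trig]
  have z : HasDerivAt (fun _ : ℝ => (0 : F)) 0 (q 0) := hasDerivAt_const _ _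
  rw [partialD_congr 0 h, partialD_congr 1 h, e, partialD_zero_trig z z hc,
    partialD_one_trig z z hc]
  simp

end Trig

/-! ### Metric, shape operator and □G of a surface of revolution -/

namespace SurfaceOfRevolution

variable (M : SurfaceOfRevolution)

theorem contDiffOn_deriv {f : ℝ → ℝ} {I : Set ℝ} (hI : IsOpen I) (hf : ContDiffOn ℝ ∞ f I) :
    ContDiffOn ℝ ∞ (deriv f) I :=
  hf.deriv_of_isOpen hI (by simp)

theorem hasDerivAt_of_contDiffOn {f : ℝ → ℝ} {I : Set ℝ} (hI : IsOpen I)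
    (hf : ContDiffOn ℝ ∞ f I) {s : ℝ} (hs : s ∈ I) : HasDerivAt f (deriv f s) s :=
  ((hf.contDiffAt (hI.mem_nhds hs)).differentiableAt (by simp)).hasDerivAt

theorem hasDerivAt_x {s : ℝ} (hs : s ∈ M.interval) : HasDerivAt M.x (deriv M.x s) s :=
  hasDerivAt_of_contDiffOn M.isOpen_interval M.smooth_x hs

theorem hasDerivAt_z {s : ℝ} (hs : s ∈ M.interval) : HasDerivAt M.z (deriv M.z s) s :=
  hasDerivAt_of_contDiffOn M.isOpen_interval M.smooth_z hs

theorem hasDerivAt_deriv_x {s : ℝ} (hs : s ∈ M.interval) :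
    HasDerivAt (deriv M.x) (deriv (deriv M.x) s) s :=
  hasDerivAt_of_contDiffOn M.isOpen_interval (contDiffOn_deriv M.isOpen_interval M.smooth_x) hs

theorem hasDerivAt_deriv_z {s : ℝ} (hs : s ∈ M.interval) :
    HasDerivAt (deriv M.z) (deriv (deriv M.z) s) s :=
  hasDerivAt_of_contDiffOn M.isOpen_interval (contDiffOn_deriv M.isOpen_interval M.smooth_z) hs

theorem hasDerivAt_deriv_deriv_x {s : ℝ} (hs : s ∈ M.interval) :
    HasDerivAt (deriv (deriv M.x)) (deriv (deriv (deriv M.x)) s) s :=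
  hasDerivAt_of_contDiffOn M.isOpen_interval
    (contDiffOn_deriv M.isOpen_interval (contDiffOn_deriv M.isOpen_interval M.smooth_x)) hs

theorem hasDerivAt_deriv_deriv_z {s : ℝ} (hs : s ∈ M.interval) :
    HasDerivAt (deriv (deriv M.z)) (deriv (deriv (deriv M.z)) s) s :=
  hasDerivAt_of_contDiffOn M.isOpen_interval
    (contDiffOn_deriv M.isOpen_interval (contDiffOn_deriv M.isOpen_interval M.smooth_z)) hs

theorem isOpen_domain : IsOpen M.domain :=
  M.isOpen_interval.preimage (continuous_apply 0)

theorem isPreconnected_domain : IsPreconnected M.domain := by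
  have h : Convex ℝ M.interval :=
    M.isConnected_interval.isPreconnected.ordConnected.convex
  exact (h.linear_preimage (LinearMap.proj (R := ℝ) (φ := fun _ : Fin 2 => ℝ) 0)).isPreconnected

theorem eventually_mem_domain {q : Fin 2 → ℝ} (hq : q ∈ M.domain) : ∀ᶠ p in 𝓝 q, p ∈ M.domain :=
  M.isOpen_domain.mem_nhds hq

/-- The horizontal unit vector pointing away from the axis. -/
def radial (t : ℝ) : E3 := Real.cos t • M.frame 0 + Real.sin t • M.frame 1

/-- The unit normal field `(-z' cos t, -z' sin t, x')`. -/
def unitNormal (q : Fin 2 → ℝ) : E3 :=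
  -deriv M.z (q 0) • M.radial (q 1) + deriv M.x (q 0) • M.frame 2

/-- The curvature of the profile curve. -/
def profileCurv (s : ℝ) : ℝ :=
  deriv M.x s * deriv (deriv M.z) s - deriv (deriv M.x) s * deriv M.z s

theorem param_eq_trig : M.param =
    trig (fun s => M.x s • M.frame 0) (fun s => M.x s • M.frame 1)
      (fun s => M.origin + M.z s • M.frame 2) := by
  ext1 q
  simp only [param, trig]
  module

theorem unitNormal_eq_trig : M.unitNormal =
    trig (fun s => -deriv M.z s • M.frame 0) (fun s => -deriv M.z s • M.frame 1)
      (fun s => deriv M.x s • M.frame 2) := by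
  ext1 q
  simp only [unitNormal, radial, trig]
  module

theorem inner_frame (i j : Fin 3) :
    inner ℝ (M.frame i) (M.frame j) = if i = j then (1 : ℝ) else 0 :=
  M.frame.inner_eq_ite i j

variable {M} {q : Fin 2 → ℝ}

theorem partialD_zero_param (hq : q ∈ M.domain) :
    partialD 0 M.param q = (deriv M.x (q 0) * Real.cos (q 1)) • M.frame 0
      + (deriv M.x (q 0) * Real.sin (q 1)) • M.frame 1 + deriv M.z (q 0) • M.frame 2 := by
  rw [param_eq_trig, partialD_zero_trig ((M.hasDerivAt_x hq).smul_const _)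
    ((M.hasDerivAt_x hq).smul_const _) (((M.hasDerivAt_z hq).smul_const _).const_add _)]
  module

theorem partialD_one_param (hq : q ∈ M.domain) :
    partialD 1 M.param q = (-(M.x (q 0) * Real.sin (q 1))) • M.frame 0
      + (M.x (q 0) * Real.cos (q 1)) • M.frame 1 := by
  rw [param_eq_trig, partialD_one_trig ((M.hasDerivAt_x hq).smul_const _)
    ((M.hasDerivAt_x hq).smul_const _) (((M.hasDerivAt_z hq).smul_const _).const_add _)]
  module

theorem partialD_zero_unitNormal (hq : q ∈ M.domain) :
    partialD 0 M.unitNormal q = (-(deriv (deriv M.z) (q 0) * Real.cos (q 1))) • M.frame 0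
      + (-(deriv (deriv M.z) (q 0) * Real.sin (q 1))) • M.frame 1
      + deriv (deriv M.x) (q 0) • M.frame 2 := by
  rw [unitNormal_eq_trig, partialD_zero_trig ((M.hasDerivAt_deriv_z hq).fun_neg.smul_const _)
    ((M.hasDerivAt_deriv_z hq).fun_neg.smul_const _) ((M.hasDerivAt_deriv_x hq).smul_const _)]
  module

theorem partialD_one_unitNormal (hq : q ∈ M.domain) :
    partialD 1 M.unitNormal q = (deriv M.z (q 0) * Real.sin (q 1)) • M.frame 0
      + (-(deriv M.z (q 0) * Real.cos (q 1))) • M.frame 1 := by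
  rw [unitNormal_eq_trig, partialD_one_trig ((M.hasDerivAt_deriv_z hq).fun_neg.smul_const _)
    ((M.hasDerivAt_deriv_z hq).fun_neg.smul_const _) ((M.hasDerivAt_deriv_x hq).smul_const _)]
  module

theorem inner_frame_combination (a b c a' b' c' : ℝ) :
    inner ℝ (a • M.frame 0 + b • M.frame 1 + c • M.frame 2)
      (a' • M.frame 0 + b' • M.frame 1 + c' • M.frame 2) = a * a' + b * b' + c * c' := by
  simp [inner_add_left, inner_add_right, inner_smul_left, inner_smul_right]
  ring

theorem inner_frame_combination_horizontal_right (a b c a' b' : ℝ) :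
    inner ℝ (a • M.frame 0 + b • M.frame 1 + c • M.frame 2)
      (a' • M.frame 0 + b' • M.frame 1) = a * a' + b * b' := by
  simpa using M.inner_frame_combination a b c a' b' 0

theorem inner_frame_combination_horizontal_left (a b a' b' c' : ℝ) :
    inner ℝ (a • M.frame 0 + b • M.frame 1)
      (a' • M.frame 0 + b' • M.frame 1 + c' • M.frame 2) = a * a' + b * b' := by
  simpa using M.inner_frame_combination a b 0 a' b' c'

theorem inner_frame_combination_horizontal (a b a' b' : ℝ) :
    inner ℝ (a • M.frame 0 + b • M.frame 1) (a' • M.frame 0 + b' • M.frame 1)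
      = a * a' + b * b' := by
  simpa using M.inner_frame_combination a b 0 a' b' 0

theorem metric_param (hq : q ∈ M.domain) :
    metric M.param q = !![1, 0; 0, M.x (q 0) ^ 2] := by
  have hu := M.unit_speed _ hq
  have hcs := Real.cos_sq_add_sin_sq (q 1)
  have h0 := partialD_zero_param hq
  have h1 := partialD_one_param hq
  ext i j
  fin_cases i <;> fin_cases j
  · change inner ℝ (partialD 0 M.param q) (partialD 0 M.param q) = (1 : ℝ)
    rw [h0, inner_frame_combination]
    linear_combination hu + deriv M.x (q 0) ^ 2 * hcs
  · change inner ℝ (partialD 0 M.param q) (partialD 1 M.param q) = (0 : ℝ)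
    rw [h0, h1, inner_frame_combination_horizontal_right]
    ring
  · change inner ℝ (partialD 1 M.param q) (partialD 0 M.param q) = (0 : ℝ)
    rw [h0, h1, inner_frame_combination_horizontal_left]
    ring
  · change inner ℝ (partialD 1 M.param q) (partialD 1 M.param q) = M.x (q 0) ^ 2
    rw [h1, inner_frame_combination_horizontal]
    linear_combination M.x (q 0) ^ 2 * hcs

theorem x_ne_zero (hq : q ∈ M.domain) : M.x (q 0) ≠ 0 := (M.x_pos _ hq).ne'

theorem metric_param_inv (hq : q ∈ M.domain) :
    (metric M.param q)⁻¹ = !![1, 0; 0, (M.x (q 0) ^ 2)⁻¹] := by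
  have := x_ne_zero hq
  rw [metric_param hq]
  refine Matrix.inv_eq_right_inv ?_
  ext i j
  fin_cases i <;> fin_cases j <;> simp [Matrix.mul_apply, Fin.sum_univ_two, this]

theorem partialD_metric_param (hq : q ∈ M.domain) (i j k : Fin 2) :
    partialD k (fun p => metric M.param p i j) q =
      if i = 1 ∧ j = 1 ∧ k = 0 then 2 * M.x (q 0) * deriv M.x (q 0) else 0 := by
  have h : ∀ i j : Fin 2, (fun p => metric M.param p i j) =ᶠ[𝓝 q]
      fun p => (fun s => (!![1, 0; 0, M.x s ^ 2] : Matrix (Fin 2) (Fin 2) ℝ) i j) (p 0) := by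
    intro i j
    filter_upwards [M.eventually_mem_domain hq] with p hp
    rw [metric_param hp]
  have h1 := (M.hasDerivAt_x hq).pow 2
  have hc : ∀ r : ℝ, HasDerivAt (fun _ : ℝ => r) 0 (q 0) := fun r => hasDerivAt_const _ _
  have e00 := partialD_of_comp_zero (c' := (0 : ℝ)) (h 0 0) (by simpa using hc 1)
  have e01 := partialD_of_comp_zero (c' := (0 : ℝ)) (h 0 1) (by simpa using hc 0)
  have e10 := partialD_of_comp_zero (c' := (0 : ℝ)) (h 1 0) (by simpa using hc 0)
  have e11 := partialD_of_comp_zero (c' := 2 * M.x (q 0) * deriv M.x (q 0)) (h 1 1)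
    (by simpa using h1)
  fin_cases i <;> fin_cases j <;> fin_cases k <;>
    first
      | simpa using e00.1
      | simpa using e00.2
      | simpa using e01.1
      | simpa using e01.2
      | simpa using e10.1
      | simpa using e10.2
      | simpa using e11.1
      | simpa using e11.2

/-- Only diagonal entries of the Hessian enter □, because the metric and the second form are
diagonal. Meridians are geodesics, so there is no Christoffel term here. -/
theorem hessForm_param_zero_zero (hq : q ∈ M.domain) (f : (Fin 2 → ℝ) → ℝ) :
    hessForm M.param f q 0 0 = partialD 0 (partialD 0 f) q := by
  simp [hessForm, christoffel, partialD_metric_param hq, metric_param_inv hq, Fin.sum_univ_two]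

theorem hessForm_param_one_one (hq : q ∈ M.domain) (f : (Fin 2 → ℝ) → ℝ) :
    hessForm M.param f q 1 1 =
      partialD 1 (partialD 1 f) q + M.x (q 0) * deriv M.x (q 0) * partialD 0 f q := by
  simp [hessForm, christoffel, partialD_metric_param hq, metric_param_inv hq, Fin.sum_univ_two]
  grind

/-- The Gauss map is `ε` times the standard unit normal, with a constant sign `ε`. -/
theorem exists_sign_gaussMap {G : (Fin 2 → ℝ) → E3} (hG : IsGaussMap M.param M.domain G) :
    ∃ ε : ℝ, ε ^ 2 = 1 ∧ ∀ q ∈ M.domain, G q = ε • M.unitNormal q := by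
  have key : ∀ q ∈ M.domain, G q = (inner ℝ (G q) (M.unitNormal q) : ℝ) • M.unitNormal q ∧
      (inner ℝ (G q) (M.unitNormal q) : ℝ) ^ 2 = 1 := by
    intro q hq
    have hx := x_ne_zero hq
    have hu := M.unit_speed _ hq
    have hcs := Real.cos_sq_add_sin_sq (q 1)
    obtain ⟨a, b, c, hg⟩ : ∃ a b c : ℝ, G q = a • M.frame 0 + b • M.frame 1 + c • M.frame 2 := by
      refine ⟨inner ℝ (M.frame 0) (G q), inner ℝ (M.frame 1) (G q), inner ℝ (M.frame 2) (G q), ?_⟩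
      conv_lhs => rw [← M.frame.sum_repr' (G q)]
      simp [Fin.sum_univ_three]
    have hn : M.unitNormal q = (-(deriv M.z (q 0) * Real.cos (q 1))) • M.frame 0
        + (-(deriv M.z (q 0) * Real.sin (q 1))) • M.frame 1 + deriv M.x (q 0) • M.frame 2 := by
      simp only [unitNormal, radial]; module
    have h0 := hG.normal q hq 0
    have h1 := hG.normal q hq 1
    have h2 : (inner ℝ (G q) (G q) : ℝ) = 1 := by
      rw [real_inner_self_eq_norm_sq, hG.norm_eq_one q hq]; norm_num
    rw [partialD_zero_param hq, hg, inner_frame_combination] at h0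
    rw [partialD_one_param hq, hg, inner_frame_combination_horizontal_right] at h1
    rw [hg, inner_frame_combination] at h2
    have h1' : b * Real.cos (q 1) = a * Real.sin (q 1) :=
      mul_left_cancel₀ hx (by linear_combination h1)
    rw [hg, hn, inner_frame_combination]
    set C := Real.cos (q 1)
    set S := Real.sin (q 1)
    set u := deriv M.x (q 0)
    set v := deriv M.z (q 0)
    set d := a * C + b * S with hd
    have ha : a = d * C := by linear_combination -a * hcs - S * h1'
    have hb : b = d * S := by linear_combination -b * hcs + C * h1'
    have hdu : d * u + c * v = 0 := by linear_combination h0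
    have hd2 : d ^ 2 + c ^ 2 = 1 := by
      rw [ha, hb] at h2
      linear_combination h2 - d ^ 2 * hcs
    have hp : a * -(v * C) + b * -(v * S) + c * u = c * u - d * v := by
      rw [hd]; ring
    rw [hp]
    have hdv : d = -(c * u - d * v) * v := by linear_combination u * hdu - d * hu
    have hcu : c = (c * u - d * v) * u := by linear_combination v * hdu - c * hu
    constructor
    · have e1 : a = (c * u - d * v) * -(v * C) := by linear_combination ha + C * hdv
      have e2 : b = (c * u - d * v) * -(v * S) := by linear_combination hb + S * hdv
      rw [smul_add, smul_add, smul_smul, smul_smul, smul_smul, ← e1, ← e2, ← hcu]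
    · linear_combination hd2 + (c ^ 2 + d ^ 2) * hu - (d * u + c * v) * hdu
  -- The sign ⟨G, N⟩ is continuous with square 1 on a connected domain, hence constant.
  have hcont : ContinuousOn (fun q => (inner ℝ (G q) (M.unitNormal q) : ℝ)) M.domain := by
    refine hG.continuousOn.inner ?_
    intro q hq
    rw [unitNormal_eq_trig]
    exact (hasFDerivAt_trig ((M.hasDerivAt_deriv_z hq).fun_neg.smul_const _)
      ((M.hasDerivAt_deriv_z hq).fun_neg.smul_const _)
      ((M.hasDerivAt_deriv_x hq).smul_const _)).continuousAt.continuousWithinAt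
  have hsq : Set.EqOn ((fun q => (inner ℝ (G q) (M.unitNormal q) : ℝ)) ^ 2) 1 M.domain :=
    fun q hq => (key q hq).2
  rcases M.isPreconnected_domain.eq_one_or_eq_neg_one_of_sq_eq hcont
    hsq with h | h
  · have h' : ∀ q ∈ M.domain, (inner ℝ (G q) (M.unitNormal q) : ℝ) = 1 := fun q hq => h hq
    exact ⟨1, by norm_num, fun q hq => (key q hq).1.trans (by rw [h' q hq])⟩
  · have h' : ∀ q ∈ M.domain, (inner ℝ (G q) (M.unitNormal q) : ℝ) = -1 := fun q hq => h hq
    exact ⟨-1, by norm_num, fun q hq => (key q hq).1.trans (by rw [h' q hq])⟩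

theorem gaussMap_eventuallyEq {G : (Fin 2 → ℝ) → E3} {ε : ℝ}
    (hε : ∀ q ∈ M.domain, G q = ε • M.unitNormal q) (hq : q ∈ M.domain) :
    G =ᶠ[𝓝 q] fun p => ε • M.unitNormal p := by
  filter_upwards [M.eventually_mem_domain hq] with p hp using hε p hp

theorem differentiableAt_unitNormal (hq : q ∈ M.domain) : DifferentiableAt ℝ M.unitNormal q := by
  rw [unitNormal_eq_trig]
  exact (hasFDerivAt_trig ((M.hasDerivAt_deriv_z hq).fun_neg.smul_const _)
    ((M.hasDerivAt_deriv_z hq).fun_neg.smul_const _)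
    ((M.hasDerivAt_deriv_x hq).smul_const _)).differentiableAt

theorem partialD_gaussMap {G : (Fin 2 → ℝ) → E3} {ε : ℝ}
    (hε : ∀ q ∈ M.domain, G q = ε • M.unitNormal q) (hq : q ∈ M.domain) (i : Fin 2) :
    partialD i G q = ε • partialD i M.unitNormal q := by
  rw [partialD_congr i (gaussMap_eventuallyEq hε hq)]
  simp only [partialD]
  rw [fderiv_fun_const_smul (differentiableAt_unitNormal hq)]
  rfl

theorem secondForm_param {G : (Fin 2 → ℝ) → E3} {ε : ℝ}
    (hε : ∀ q ∈ M.domain, G q = ε • M.unitNormal q) (hq : q ∈ M.domain) :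
    secondForm M.param G q =
      !![ε * M.profileCurv (q 0), 0; 0, ε * (M.x (q 0) * deriv M.z (q 0))] := by
  have hcs := Real.cos_sq_add_sin_sq (q 1)
  have h0 := partialD_zero_param hq
  have h1 := partialD_one_param hq
  have g0 := partialD_gaussMap hε hq 0
  have g1 := partialD_gaussMap hε hq 1
  rw [partialD_zero_unitNormal hq] at g0
  rw [partialD_one_unitNormal hq] at g1
  ext i j
  fin_cases i <;> fin_cases j
  · change -inner ℝ (partialD 0 G q) (partialD 0 M.param q) = ε * M.profileCurv (q 0)
    rw [h0, g0, real_inner_smul_left, inner_frame_combination, profileCurv]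
    linear_combination ε * deriv (deriv M.z) (q 0) * deriv M.x (q 0) * hcs
  · change -inner ℝ (partialD 1 G q) (partialD 0 M.param q) = (0 : ℝ)
    rw [h0, g1, real_inner_smul_left, inner_frame_combination_horizontal_left]
    ring
  · change -inner ℝ (partialD 0 G q) (partialD 1 M.param q) = (0 : ℝ)
    rw [h1, g0, real_inner_smul_left, inner_frame_combination_horizontal_right]
    ring
  · change -inner ℝ (partialD 1 G q) (partialD 1 M.param q) = ε * (M.x (q 0) * deriv M.z (q 0))
    rw [h1, g1, real_inner_smul_left, inner_frame_combination_horizontal]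
    linear_combination ε * deriv M.z (q 0) * M.x (q 0) * hcs

/-- tr(S) I - S exchanges the two principal curvatures: the second derivative along the meridian is
weighted by the parallel curvature, the one along the parallel by the profile curvature. -/
theorem chengYau_param {G : (Fin 2 → ℝ) → E3} {ε : ℝ}
    (hε : ∀ q ∈ M.domain, G q = ε • M.unitNormal q) (hq : q ∈ M.domain) (f : (Fin 2 → ℝ) → ℝ) :
    chengYau M.param G f q = -ε * (deriv M.z (q 0) / M.x (q 0) * partialD 0 (partialD 0 f) q
      + M.profileCurv (q 0) * (partialD 1 (partialD 1 f) q / M.x (q 0) ^ 2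
        + deriv M.x (q 0) / M.x (q 0) * partialD 0 f q)) := by
  have hx := x_ne_zero hq
  simp only [chengYau, shapeOp, hessOp, secondForm_param hε hq, metric_param_inv hq]
  rw [Matrix.eta_fin_two (hessForm M.param f q), hessForm_param_zero_zero hq,
    hessForm_param_one_one hq]
  simp [Matrix.trace_fin_two, Matrix.one_fin_two]
  field_simp
  ring

/-- The radial component of `□ G`. -/
def radialCoeff (M : SurfaceOfRevolution) (s : ℝ) : ℝ :=
  deriv M.z s / M.x s * deriv (deriv (deriv M.z)) s
    + M.profileCurv s * (deriv M.x s / M.x s * deriv (deriv M.z) s - deriv M.z s / M.x s ^ 2)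

/-- The axial component of `□ G`. -/
def axialCoeff (M : SurfaceOfRevolution) (s : ℝ) : ℝ :=
  -(deriv M.z s / M.x s * deriv (deriv (deriv M.x)) s
    + M.profileCurv s * (deriv M.x s / M.x s * deriv (deriv M.x) s))

/-- The sign ε enters once through S and once through G, so it cancels. The coordinates of G are
trigonometric in t, a class stable under both partial derivatives. -/
theorem chengYauGauss_param {G : (Fin 2 → ℝ) → E3} {ε : ℝ} (hε2 : ε ^ 2 = 1)
    (hε : ∀ q ∈ M.domain, G q = ε • M.unitNormal q) (hq : q ∈ M.domain) :
    chengYauGauss M.param G q =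
      M.radialCoeff (q 0) • M.radial (q 1) + M.axialCoeff (q 0) • M.frame 2 := by
  ext i
  have hf : ∀ p ∈ M.domain, (fun p => G p i) =ᶠ[𝓝 p]
      trig (fun s => -deriv M.z s * (ε * M.frame 0 i)) (fun s => -deriv M.z s * (ε * M.frame 1 i))
        (fun s => deriv M.x s * (ε * M.frame 2 i)) := by
    intro p hp
    filter_upwards [M.eventually_mem_domain hp] with r hr
    rw [hε r hr]
    simp [unitNormal, radial, trig]
    ring
  have hd0 : partialD 0 (fun p => G p i) =ᶠ[𝓝 q]
      trig (fun s => -deriv (deriv M.z) s * (ε * M.frame 0 i))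
        (fun s => -deriv (deriv M.z) s * (ε * M.frame 1 i))
        (fun s => deriv (deriv M.x) s * (ε * M.frame 2 i)) := by
    filter_upwards [M.eventually_mem_domain hq] with p hp
    rw [partialD_congr 0 (hf p hp), partialD_zero_trig
      ((M.hasDerivAt_deriv_z hp).fun_neg.mul_const _)
      ((M.hasDerivAt_deriv_z hp).fun_neg.mul_const _) ((M.hasDerivAt_deriv_x hp).mul_const _)]
    rfl
  have hd1 : partialD 1 (fun p => G p i) =ᶠ[𝓝 q]
      trig (fun s => -deriv M.z s * (ε * M.frame 1 i)) (fun s => deriv M.z s * (ε * M.frame 0 i))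
        (fun _ => 0) := by
    filter_upwards [M.eventually_mem_domain hq] with p hp
    rw [partialD_congr 1 (hf p hp), partialD_one_trig
      ((M.hasDerivAt_deriv_z hp).fun_neg.mul_const _)
      ((M.hasDerivAt_deriv_z hp).fun_neg.mul_const _) ((M.hasDerivAt_deriv_x hp).mul_const _)]
    simp [trig]
  change chengYau M.param G (fun p => G p i) q = _
  rw [chengYau_param hε hq, partialD_congr 0 hd0, partialD_congr 1 hd1, hd0.eq_of_nhds,
    partialD_zero_trig ((M.hasDerivAt_deriv_deriv_z hq).fun_neg.mul_const _)
      ((M.hasDerivAt_deriv_deriv_z hq).fun_neg.mul_const _)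
      ((M.hasDerivAt_deriv_deriv_x hq).mul_const _),
    partialD_one_trig ((M.hasDerivAt_deriv_z hq).fun_neg.mul_const _)
      ((M.hasDerivAt_deriv_z hq).mul_const _) (hasDerivAt_const _ _)]
  have hr := radialCoeff.eq_1 M (q 0)
  have ha := axialCoeff.eq_1 M (q 0)
  simp [trig, radial]
  linear_combination
    (M.radialCoeff (q 0) * (Real.cos (q 1) * M.frame 0 i + Real.sin (q 1) * M.frame 1 i)
      + M.axialCoeff (q 0) * M.frame 2 i) * hε2
    - ε ^ 2 * (Real.cos (q 1) * M.frame 0 i + Real.sin (q 1) * M.frame 1 i) * hr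
    - ε ^ 2 * M.frame 2 i * ha

end SurfaceOfRevolution

/-! ### Elimination in the curvature equations -/

theorem HasDerivAt.unique_of_eventuallyEq {f g : ℝ → ℝ} {a b s : ℝ} (hf : HasDerivAt f a s)
    (hg : HasDerivAt g b s) (h : f =ᶠ[𝓝 s] g) : a = b :=
  hf.unique (hg.congr_of_eventuallyEq h)

/-- For the principal curvatures `k, w` of a unit speed profile with velocity `(c, u)`, the
equations `K' = (μ - l) c u` and `(k + w) K = μ c² + l u²` force `K K' = 0`, where `K = k w`. -/
theorem curvature_mul_deriv_eq_zero {I : Set ℝ} (hI : IsOpen I) {x c u k w k' : ℝ → ℝ} {μ l : ℝ}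
    (hx : ∀ s ∈ I, 0 < x s)
    (hc : ∀ s ∈ I, HasDerivAt c (-(k s * u s)) s)
    (hu : ∀ s ∈ I, HasDerivAt u (k s * c s) s)
    (hk : ∀ s ∈ I, HasDerivAt k (k' s) s)
    (hw : ∀ s ∈ I, HasDerivAt w ((k s - w s) * (c s / x s)) s)
    (hunit : ∀ s ∈ I, c s ^ 2 + u s ^ 2 = 1)
    (hux : ∀ s ∈ I, u s = w s * x s)
    (hA : ∀ s ∈ I, k' s * w s + k s * ((k s - w s) * (c s / x s)) = (μ - l) * c s * u s)
    (hB : ∀ s ∈ I, (k s + w s) * (k s * w s) = μ * c s ^ 2 + l * u s ^ 2)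
    {s : ℝ} (hs : s ∈ I) :
    k s * w s * (k' s * w s + k s * ((k s - w s) * (c s / x s))) = 0 := by
  -- Differentiating `hB` produces -2k (μ - l) c u on the right, which is -2k K' by `hA`; μ and l
  -- disappear.
  have hR : ∀ s ∈ I, k' s * (w s * (w s + 4 * k s))
      = -k s * (3 * k s + 2 * w s) * ((k s - w s) * (c s / x s)) := by
    intro s hs
    have h1 := ((hk s hs).fun_add (hw s hs)).fun_mul ((hk s hs).fun_mul (hw s hs))
    have h2 := (((hc s hs).fun_pow 2).const_mul μ).fun_add (((hu s hs).fun_pow 2).const_mul l)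
    have h3 := h1.unique_of_eventuallyEq h2 (by
      filter_upwards [hI.mem_nhds hs] with p hp using hB p hp)
    simp at h3
    linear_combination h3 + 2 * k s * hA s hs
  by_contra hne
  -- K' is replaced by (μ - l) c u, whose continuity is known while k' need not be continuous. So K
  -- K' ≠ 0 on a neighbourhood, and identities may be differentiated there.
  have hcont : ∀ᶠ p in 𝓝 s, p ∈ I ∧ k p * w p * ((μ - l) * c p * u p) ≠ 0 := by
    refine Filter.Eventually.and (hI.mem_nhds hs) ?_
    have hcts : ContinuousAt (fun p => k p * w p * ((μ - l) * c p * u p)) s :=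
      ((hk s hs).continuousAt.mul (hw s hs).continuousAt).mul
        ((continuousAt_const.mul (hc s hs).continuousAt).mul (hu s hs).continuousAt)
    exact hcts.eventually_ne (by rwa [hA s hs] at hne)
  have hE : ∀ p, p ∈ I ∧ k p * w p * ((μ - l) * c p * u p) ≠ 0 →
      (k p * w p * (5 * k p ^ 2 + 3 * k p * w p + 2 * w p ^ 2) = μ * (w p + 4 * k p)) ∧
      k p ≠ w p := by
    rintro p ⟨hp, hn⟩
    have hxp := (hx p hp).ne'
    have hc0 : c p ≠ 0 := by rintro h; simp [h] at hn
    have hu0 : u p ≠ 0 := by rintro h; simp [h] at hn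
    have hw0 : w p ≠ 0 := by rintro h; simp [h] at hn
    have hml : μ - l ≠ 0 := by rintro h; simp [h] at hn
    have hy : c p = c p / x p * x p := by field_simp
    have hy0 : c p / x p ≠ 0 := div_ne_zero hc0 hxp
    -- `hA` and `hR` eliminate k', and u = w x removes the factor c / x. Adding (w + 4k) times `hB`
    -- then eliminates l, by c² + u² = 1.
    have e0 : k p * w p * (k p - w p) ^ 2 = (μ - l) * u p ^ 2 * (w p + 4 * k p) := by
      refine mul_left_cancel₀ hy0 ?_
      have a := hA p hp
      have r := hR p hp
      have v := hux p hp
      have e : (μ - l) * c p * u p * (w p + 4 * k p) = k p * (k p - w p) ^ 2 * (c p / x p) := by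
        linear_combination -(w p + 4 * k p) * a + r
      have e' : (c p / x p) * u p = c p * w p := by rw [v]; field_simp
      linear_combination -w p * e - (μ - l) * u p * (w p + 4 * k p) * e'
    constructor
    · linear_combination e0 + (w p + 4 * k p) * hB p hp + μ * (w p + 4 * k p) * hunit p hp
    · intro h
      rw [h] at e0
      have : (μ - l) * u p ^ 2 * (w p + 4 * w p) ≠ 0 := by
        have : w p + 4 * w p = 5 * w p := by ring
        rw [this]
        positivity
      exact this (by rw [← e0]; ring)
  have hQ : ∀ p, p ∈ I ∧ k p * w p * ((μ - l) * c p * u p) ≠ 0 →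
      (∀ᶠ r in 𝓝 p, r ∈ I ∧ k r * w r * ((μ - l) * c r * u r) ≠ 0) →
      8 * k p ^ 2 + 17 * k p * w p + 5 * w p ^ 2 = 0 := by
    intro p hp hev
    obtain ⟨e1, hkw⟩ := hE p hp
    obtain ⟨hp, hn⟩ := hp
    have hxp := (hx p hp).ne'
    have hc0 : c p ≠ 0 := by rintro h; simp [h] at hn
    have hw0 : w p ≠ 0 := by rintro h; simp [h] at hn
    have hk0 : k p ≠ 0 := by rintro h; simp [h] at hn
    have hy0 : c p / x p ≠ 0 := div_ne_zero hc0 hxp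
    have hk1 := hk p hp
    have hw1 := hw p hp
    have h1 := (hk1.fun_mul hw1).fun_mul ((((hk1.fun_pow 2).const_mul 5).fun_add
      ((hk1.const_mul 3).fun_mul hw1)).fun_add ((hw1.fun_pow 2).const_mul 2))
    have h2 := (hw1.fun_add (hk1.const_mul 4)).const_mul μ
    have h3 := h1.unique_of_eventuallyEq h2 (by filter_upwards [hev] with r hr using (hE r hr).1)
    have r := hR p hp
    simp at h3
    have hkw' := sub_ne_zero.mpr hkw
    -- Derivative of the first relation of `hE`, with k' eliminated by `hR` and μ by the relation
    -- itself; what remains is homogeneous in k and w.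
    have : (c p / x p) * (k p - w p) * (k p ^ 2 * w p * (k p - w p)) *
        (8 * k p ^ 2 + 17 * k p * w p + 5 * w p ^ 2) = 0 := by
      linear_combination (-1 / 5) * ((w p + 4 * k p) ^ 2 * w p * h3
        - (15 * k p ^ 2 * w p + 6 * k p * w p ^ 2 + 2 * w p ^ 3 - 4 * μ) * (w p + 4 * k p) * r
        + (4 * k p * (3 * k p + 2 * w p) - w p * (w p + 4 * k p))
          * ((k p - w p) * (c p / x p)) * e1)
    simpa [hy0, hkw', hk0, hw0] using this
  obtain ⟨⟨hsI, hn⟩, hkw⟩ := (⟨hcont.self_of_nhds, (hE s hcont.self_of_nhds).2⟩ : _ ∧ _)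
  have hev : ∀ᶠ p in 𝓝 s, 8 * k p ^ 2 + 17 * k p * w p + 5 * w p ^ 2 = 0 := by
    filter_upwards [hcont, eventually_eventually_nhds.mpr hcont] with p h1 h2 using hQ p h1 h2
  have hk1 := hk s hs
  have hw1 := hw s hs
  have h1 := (((hk1.fun_pow 2).const_mul 8).fun_add
    ((hk1.const_mul 17).fun_mul hw1)).fun_add ((hw1.fun_pow 2).const_mul 5)
  have h3 := h1.unique_of_eventuallyEq (hasDerivAt_const s (0 : ℝ)) hev
  have hq := hev.self_of_nhds
  have hc0 : c s ≠ 0 := by rintro h; simp [h] at hn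
  have hw0 : w s ≠ 0 := by rintro h; simp [h] at hn
  have hy0 : c s / x s ≠ 0 := div_ne_zero hc0 (hx s hs).ne'
  have r := hR s hs
  simp at h3
  -- Derivative of the quadratic, with k' again eliminated by `hR`. The cubic and the quadratic have
  -- no common root with w ≠ 0, as the Euclidean algorithm in `h6`, `h7`, `h8` shows.
  have h4 : (c s / x s) * (k s - w s) *
      (-48 * k s ^ 3 - 15 * k s ^ 2 * w s + 23 * k s * w s ^ 2 + 10 * w s ^ 3) = 0 := by
    linear_combination w s * (w s + 4 * k s) * h3 - (16 * k s + 17 * w s) * r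
  have h5 : -48 * k s ^ 3 - 15 * k s ^ 2 * w s + 23 * k s * w s ^ 2 + 10 * w s ^ 3 = 0 := by
    simpa [hy0, sub_ne_zero.mpr hkw] using h4
  have h6 : 87 * k s ^ 2 + 53 * k s * w s + 10 * w s ^ 2 = 0 :=
    mul_left_cancel₀ hw0 (by linear_combination h5 + 6 * k s * hq)
  have h7 : 211 * k s = -71 * w s :=
    mul_left_cancel₀ hw0 (by linear_combination (-8 * h6 + 87 * hq) / 5)
  have h8 : w s ^ 2 = 0 := by
    linear_combination (211 ^ 2 * hq - (8 * (211 * k s - 71 * w s) + 17 * 211 * w s) * h7) / 8256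
  exact hw0 (by simpa using h8)

theorem IsPreconnected.exists_eq_const_of_hasDerivAt_zero {I : Set ℝ} (hI : IsOpen I)
    (hc : IsPreconnected I) {f : ℝ → ℝ} (hf : ∀ s ∈ I, HasDerivAt f 0 s) :
    ∃ a, ∀ s ∈ I, f s = a :=
  hI.exists_is_const_of_deriv_eq_zero hc
    (fun s hs => (hf s hs).differentiableAt.differentiableWithinAt) fun s hs => (hf s hs).deriv

/-! ### Classification of the profile curves -/

namespace SurfaceOfRevolution

variable {M : SurfaceOfRevolution} {s : ℝ}

theorem deriv_mul_deriv_deriv (hs : s ∈ M.interval) :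
    deriv M.x s * deriv (deriv M.x) s + deriv M.z s * deriv (deriv M.z) s = 0 := by
  have h := ((M.hasDerivAt_deriv_x hs).fun_pow 2).fun_add ((M.hasDerivAt_deriv_z hs).fun_pow 2)
  have h2 := h.unique_of_eventuallyEq (hasDerivAt_const s (1 : ℝ)) (by
    filter_upwards [M.isOpen_interval.mem_nhds hs] with p hp using M.unit_speed p hp)
  simp at h2
  linear_combination h2 / 2

theorem deriv_deriv_x (hs : s ∈ M.interval) :
    deriv (deriv M.x) s = -(M.profileCurv s * deriv M.z s) := by
  rw [profileCurv]
  linear_combination -deriv (deriv M.x) s * M.unit_speed s hs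
    + deriv M.x s * deriv_mul_deriv_deriv hs

theorem deriv_deriv_z (hs : s ∈ M.interval) :
    deriv (deriv M.z) s = M.profileCurv s * deriv M.x s := by
  rw [profileCurv]
  linear_combination -deriv (deriv M.z) s * M.unit_speed s hs
    + deriv M.z s * deriv_mul_deriv_deriv hs

theorem hasDerivAt_profileCurv (hs : s ∈ M.interval) :
    HasDerivAt M.profileCurv (deriv M.profileCurv s) s := by
  have h := ((M.hasDerivAt_deriv_x hs).fun_mul (M.hasDerivAt_deriv_deriv_z hs)).fun_sub
    ((M.hasDerivAt_deriv_deriv_x hs).fun_mul (M.hasDerivAt_deriv_z hs))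
  have h' : DifferentiableAt ℝ M.profileCurv s := h.differentiableAt
  exact h'.hasDerivAt

variable (M) in
/-- The principal curvature along the parallels. -/
def parallelCurv (s : ℝ) : ℝ := deriv M.z s / M.x s

theorem deriv_z_eq (hs : s ∈ M.interval) : deriv M.z s = M.parallelCurv s * M.x s := by
  have := (M.x_pos s hs).ne'
  rw [parallelCurv]; field_simp

/-- This is the Codazzi equation of a surface of revolution. -/
theorem hasDerivAt_parallelCurv (hs : s ∈ M.interval) :
    HasDerivAt M.parallelCurv
      ((M.profileCurv s - M.parallelCurv s) * (deriv M.x s / M.x s)) s := by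
  have hx := (M.x_pos s hs).ne'
  refine ((M.hasDerivAt_deriv_z hs).fun_div (M.hasDerivAt_x hs) hx).congr_deriv ?_
  rw [deriv_deriv_z hs, parallelCurv]
  field_simp

variable (M) in
/-- The derivative of the Gauss curvature along the profile curve. -/
def gaussCurvDeriv (s : ℝ) : ℝ :=
  deriv M.profileCurv s * M.parallelCurv s
    + M.profileCurv s * ((M.profileCurv s - M.parallelCurv s) * (deriv M.x s / M.x s))

theorem hasDerivAt_gaussCurv (hs : s ∈ M.interval) :
    HasDerivAt (fun s => M.profileCurv s * M.parallelCurv s) (M.gaussCurvDeriv s) s :=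
  (hasDerivAt_profileCurv hs).fun_mul (hasDerivAt_parallelCurv hs)

theorem deriv_deriv_deriv_x (hs : s ∈ M.interval) :
    deriv (deriv (deriv M.x)) s =
      -(deriv M.profileCurv s * deriv M.z s + M.profileCurv s ^ 2 * deriv M.x s) := by
  have h := ((hasDerivAt_profileCurv hs).fun_mul (M.hasDerivAt_deriv_z hs)).fun_neg
  have h2 := (M.hasDerivAt_deriv_deriv_x hs).unique_of_eventuallyEq h (by
    filter_upwards [M.isOpen_interval.mem_nhds hs] with p hp using deriv_deriv_x hp)
  rw [h2, deriv_deriv_z hs]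
  ring

theorem deriv_deriv_deriv_z (hs : s ∈ M.interval) :
    deriv (deriv (deriv M.z)) s =
      deriv M.profileCurv s * deriv M.x s - M.profileCurv s ^ 2 * deriv M.z s := by
  have h := (hasDerivAt_profileCurv hs).fun_mul (M.hasDerivAt_deriv_x hs)
  have h2 := (M.hasDerivAt_deriv_deriv_z hs).unique_of_eventuallyEq h (by
    filter_upwards [M.isOpen_interval.mem_nhds hs] with p hp using deriv_deriv_z hp)
  rw [h2, deriv_deriv_x hs]
  ring

/-- The radial part of `□ G = ∇K + tr(S) K G`. -/
theorem radialCoeff_eq (hs : s ∈ M.interval) :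
    M.radialCoeff s = M.gaussCurvDeriv s * deriv M.x s
      - (M.profileCurv s + M.parallelCurv s) * (M.profileCurv s * M.parallelCurv s)
        * deriv M.z s := by
  have hx := (M.x_pos s hs).ne'
  have hu := M.unit_speed s hs
  rw [radialCoeff, gaussCurvDeriv, deriv_deriv_deriv_z hs, deriv_deriv_z hs, parallelCurv]
  field_simp
  linear_combination deriv M.z s * M.profileCurv s * hu

/-- The axial part of `□ G = ∇K + tr(S) K G`. -/
theorem axialCoeff_eq (hs : s ∈ M.interval) :
    M.axialCoeff s = M.gaussCurvDeriv s * deriv M.z s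
      + (M.profileCurv s + M.parallelCurv s) * (M.profileCurv s * M.parallelCurv s)
        * deriv M.x s := by
  have hx := (M.x_pos s hs).ne'
  rw [axialCoeff, gaussCurvDeriv, deriv_deriv_deriv_x hs, deriv_deriv_x hs, parallelCurv]
  field_simp
  ring

variable (M) in
/-- The profile curve is a straight line segment. -/
def IsFlat : Prop := ∀ s ∈ M.interval, deriv (deriv M.x) s = 0

variable (M) in
/-- The profile curve is an arc of a circle centred on the axis. -/
def IsSpherical : Prop :=
  ∃ p z₀ : ℝ, p ≠ 0 ∧ ∀ s ∈ M.interval, M.x s = p * deriv M.z s ∧ M.z s = z₀ - p * deriv M.x s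

/-- The identity x'' = -k z' = -K x with x > 0 shows that `IsFlat` means vanishing Gauss curvature.
-/
theorem gaussCurv_eq_zero_iff (hs : s ∈ M.interval) :
    M.profileCurv s * M.parallelCurv s = 0 ↔ deriv (deriv M.x) s = 0 := by
  have hx := (M.x_pos s hs).ne'
  rw [deriv_deriv_x hs, deriv_z_eq hs]
  simp [hx]

theorem IsFlat.coeff_eq_zero (h : M.IsFlat) (hs : s ∈ M.interval) :
    M.radialCoeff s = 0 ∧ M.axialCoeff s = 0 := by
  have hK := (gaussCurv_eq_zero_iff hs).2 (h s hs)
  have hK' : M.gaussCurvDeriv s = 0 :=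
    (hasDerivAt_gaussCurv hs).unique_of_eventuallyEq (hasDerivAt_const s (0 : ℝ)) (by
      filter_upwards [M.isOpen_interval.mem_nhds hs] with p hp
        using (gaussCurv_eq_zero_iff hp).2 (h p hp))
  rw [radialCoeff_eq hs, axialCoeff_eq hs, hK, hK']
  simp

theorem IsSpherical.exists_coeff (h : M.IsSpherical) :
    ∃ l : ℝ, ∀ s ∈ M.interval,
      M.radialCoeff s = -(l * deriv M.z s) ∧ M.axialCoeff s = l * deriv M.x s := by
  obtain ⟨p, z₀, hp, h⟩ := h
  have hw : ∀ s ∈ M.interval, M.parallelCurv s = p⁻¹ := by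
    intro s hs
    have hx := (M.x_pos s hs).ne'
    rw [parallelCurv]
    field_simp
    linear_combination -(h s hs).1
  have hk : ∀ s ∈ M.interval, M.profileCurv s = p⁻¹ := by
    intro s hs
    have hx := (M.x_pos s hs).ne'
    have h1 := (M.hasDerivAt_z hs).unique_of_eventuallyEq
      (((M.hasDerivAt_deriv_x hs).const_mul p).const_sub z₀) (by
        filter_upwards [M.isOpen_interval.mem_nhds hs] with q hq using (h q hq).2)
    rw [deriv_deriv_x hs] at h1
    have hz : deriv M.z s ≠ 0 := by
      intro hz
      exact hx (by rw [(h s hs).1, hz, mul_zero])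
    have h2 : p * M.profileCurv s = 1 := mul_right_cancel₀ hz (by linear_combination -h1)
    field_simp
    linear_combination h2
  refine ⟨2 * p⁻¹ ^ 3, fun s hs => ?_⟩
  have hK' : M.gaussCurvDeriv s = 0 :=
    (hasDerivAt_gaussCurv hs).unique_of_eventuallyEq (hasDerivAt_const s (p⁻¹ * p⁻¹)) (by
      filter_upwards [M.isOpen_interval.mem_nhds hs] with q hq
      rw [hk q hq, hw q hq])
  rw [radialCoeff_eq hs, axialCoeff_eq hs, hK', hk s hs, hw s hs]
  constructor <;> ring

/-- The two assumptions are the equation □G = AG in the radial and axial directions; rotating them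
into the tangent and normal directions gives `hA` and `hB`. -/
theorem isFlat_or_isSpherical_of_coeff {l μ : ℝ}
    (h : ∀ s ∈ M.interval,
      M.radialCoeff s = -(l * deriv M.z s) ∧ M.axialCoeff s = μ * deriv M.x s) :
    M.IsFlat ∨ M.IsSpherical := by
  have hI := M.isOpen_interval
  have hconn := M.isConnected_interval.isPreconnected
  have hA : ∀ s ∈ M.interval, M.gaussCurvDeriv s = (μ - l) * deriv M.x s * deriv M.z s := by
    intro s hs
    obtain ⟨h1, h2⟩ := h s hs
    rw [radialCoeff_eq hs] at h1
    rw [axialCoeff_eq hs] at h2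
    linear_combination -M.gaussCurvDeriv s * M.unit_speed s hs + deriv M.x s * h1
      + deriv M.z s * h2
  have hB : ∀ s ∈ M.interval,
      (M.profileCurv s + M.parallelCurv s) * (M.profileCurv s * M.parallelCurv s)
        = μ * deriv M.x s ^ 2 + l * deriv M.z s ^ 2 := by
    intro s hs
    obtain ⟨h1, h2⟩ := h s hs
    rw [radialCoeff_eq hs] at h1
    rw [axialCoeff_eq hs] at h2
    linear_combination -((M.profileCurv s + M.parallelCurv s)
      * (M.profileCurv s * M.parallelCurv s)) * M.unit_speed s hs - deriv M.z s * h1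
      + deriv M.x s * h2
  have hKK : ∀ s ∈ M.interval, M.profileCurv s * M.parallelCurv s * M.gaussCurvDeriv s = 0 :=
    fun s hs => curvature_mul_deriv_eq_zero hI M.x_pos
      (fun s hs => (M.hasDerivAt_deriv_x hs).congr_deriv (deriv_deriv_x hs))
      (fun s hs => (M.hasDerivAt_deriv_z hs).congr_deriv (deriv_deriv_z hs))
      (fun s hs => hasDerivAt_profileCurv hs) (fun s hs => hasDerivAt_parallelCurv hs)
      M.unit_speed (fun s hs => deriv_z_eq hs) hA hB hs
  -- K K' = 0 says (K²)' = 0, so that K vanishes either everywhere or nowhere.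
  obtain ⟨a, ha⟩ := hconn.exists_eq_const_of_hasDerivAt_zero hI
    (f := fun s => (M.profileCurv s * M.parallelCurv s) ^ 2) fun s hs =>
      ((hasDerivAt_gaussCurv hs).fun_pow 2).congr_deriv (by
        simp only [Nat.cast_ofNat, Nat.add_one_sub_one, pow_one]
        linear_combination 2 * hKK s hs)
  rcases eq_or_ne a 0 with rfl | ha0
  · left
    intro s hs
    exact (gaussCurv_eq_zero_iff hs).1 (by simpa using ha s hs)
  have hK0 : ∀ s ∈ M.interval, M.profileCurv s * M.parallelCurv s ≠ 0 := by
    intro s hs h0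
    exact ha0 (by rw [← ha s hs, h0]; ring)
  have hK' : ∀ s ∈ M.interval, M.gaussCurvDeriv s = 0 := fun s hs => by
    have := hKK s hs
    simpa [hK0 s hs] using this
  by_cases hflat : ∀ s ∈ M.interval, deriv M.x s = 0
  · left
    intro s hs
    exact (M.hasDerivAt_deriv_x hs).unique_of_eventuallyEq (hasDerivAt_const s (0 : ℝ)) (by
      filter_upwards [hI.mem_nhds hs] with q hq using hflat q hq)
  push Not at hflat
  obtain ⟨s₀, hs₀, hx₀⟩ := hflat
  have hz : ∀ s ∈ M.interval, deriv M.z s ≠ 0 := by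
    intro s hs h0
    exact hK0 s hs (by simp [parallelCurv, h0])
  have hμ : μ = l := by
    have h1 := hA s₀ hs₀
    rw [hK' s₀ hs₀] at h1
    have h2 : (μ - l) * deriv M.x s₀ * deriv M.z s₀ = 0 := h1.symm
    simpa [hx₀, hz s₀ hs₀, sub_eq_zero] using h2
  subst hμ
  -- With μ = l both k + w and K are constant, so k' = -w' and w' (k - w) = 0. As w' is itself a
  -- multiple of k - w, it vanishes.
  have hw' : ∀ s ∈ M.interval,
      (M.profileCurv s - M.parallelCurv s) * (deriv M.x s / M.x s) = 0 := by
    intro s hs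
    have h1 := ((hasDerivAt_profileCurv hs).fun_add (hasDerivAt_parallelCurv hs)).fun_mul
      (hasDerivAt_gaussCurv hs)
    have h2 := h1.unique_of_eventuallyEq (hasDerivAt_const s μ) (by
      filter_upwards [hI.mem_nhds hs] with q hq
      rw [hB q hq]
      linear_combination μ * M.unit_speed q hq)
    rw [hK' s hs, mul_zero, add_zero] at h2
    have h3 := (mul_eq_zero.1 h2).resolve_right (hK0 s hs)
    have h4 := hK' s hs
    rw [gaussCurvDeriv] at h4
    set d := (M.profileCurv s - M.parallelCurv s) * (deriv M.x s / M.x s) with hd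
    have h5 : d * (M.profileCurv s - M.parallelCurv s) = 0 := by
      linear_combination h4 - M.parallelCurv s * h3
    rcases mul_eq_zero.1 h5 with h6 | h6
    · exact h6
    · rw [hd, h6, zero_mul]
  obtain ⟨b, hb⟩ := hconn.exists_eq_const_of_hasDerivAt_zero hI
    (f := M.parallelCurv) fun s hs => (hasDerivAt_parallelCurv hs).congr_deriv (hw' s hs)
  have hb0 : b ≠ 0 := by
    rintro rfl
    exact hK0 s₀ hs₀ (by rw [hb s₀ hs₀, mul_zero])
  have hk₀ : M.profileCurv s₀ = b := by
    have h1 := hw' s₀ hs₀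
    rw [hb s₀ hs₀] at h1
    have h2 : deriv M.x s₀ / M.x s₀ ≠ 0 := div_ne_zero hx₀ (M.x_pos s₀ hs₀).ne'
    simpa [h2, sub_eq_zero, (M.x_pos s₀ hs₀).ne', hx₀] using h1
  have hk : ∀ s ∈ M.interval, M.profileCurv s = b := by
    intro s hs
    have h1 : M.profileCurv s * M.parallelCurv s = M.profileCurv s₀ * M.parallelCurv s₀ := by
      obtain ⟨e, he⟩ := hconn.exists_eq_const_of_hasDerivAt_zero hI
        (f := fun s => M.profileCurv s * M.parallelCurv s)
        fun s hs => (hasDerivAt_gaussCurv hs).congr_deriv (hK' s hs)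
      rw [he s hs, he s₀ hs₀]
    simp only [hb s hs, hb s₀ hs₀, hk₀] at h1
    exact mul_right_cancel₀ hb0 h1
  -- z₀ is the height of the centre of the circle and 1/b its signed radius.
  obtain ⟨z₀, hz₀⟩ := hconn.exists_eq_const_of_hasDerivAt_zero hI
    (f := fun s => M.z s + b⁻¹ * deriv M.x s) fun s hs =>
      ((M.hasDerivAt_z hs).fun_add ((M.hasDerivAt_deriv_x hs).const_mul b⁻¹)).congr_deriv (by
        rw [deriv_deriv_x hs, hk s hs]; field_simp; ring)
  refine Or.inr ⟨b⁻¹, z₀, inv_ne_zero hb0, fun s hs => ⟨?_, ?_⟩⟩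
  · rw [deriv_z_eq hs, hb s hs]; field_simp
  · linear_combination hz₀ s hs

/-- The profile of a flat surface of revolution is affine. -/
theorem IsFlat.exists_velocity (h : M.IsFlat) :
    ∃ a b : ℝ, a ^ 2 + b ^ 2 = 1 ∧ ∀ s ∈ M.interval, deriv M.x s = a ∧ deriv M.z s = b := by
  have hI := M.isOpen_interval
  have hconn := M.isConnected_interval.isPreconnected
  obtain ⟨a, ha⟩ := hconn.exists_eq_const_of_hasDerivAt_zero hI
    fun s hs => (M.hasDerivAt_deriv_x hs).congr_deriv (h s hs)
  have hsq : ∀ s ∈ M.interval, deriv M.z s ^ 2 = 1 - a ^ 2 := by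
    intro s hs
    rw [← ha s hs]
    linear_combination M.unit_speed s hs
  have hz : ∀ s ∈ M.interval, deriv (deriv M.z) s = 0 := by
    intro s hs
    by_cases h0 : deriv M.z s = 0
    · refine (M.hasDerivAt_deriv_z hs).unique_of_eventuallyEq (hasDerivAt_const s (0 : ℝ)) ?_
      filter_upwards [hI.mem_nhds hs] with q hq
      have h1 : deriv M.z q ^ 2 = 0 := by rw [hsq q hq, ← hsq s hs, h0]; ring
      simpa using h1
    · have h1 := deriv_mul_deriv_deriv hs
      rw [h s hs, mul_zero, zero_add] at h1
      exact (mul_eq_zero.1 h1).resolve_left h0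
  obtain ⟨b, hb⟩ := hconn.exists_eq_const_of_hasDerivAt_zero hI
    fun s hs => (M.hasDerivAt_deriv_z hs).congr_deriv (hz s hs)
  obtain ⟨s, hs⟩ := M.isConnected_interval.nonempty
  refine ⟨a, b, ?_, fun s hs => ⟨ha s hs, hb s hs⟩⟩
  rw [← ha s hs, ← hb s hs, M.unit_speed s hs]

/-- `□ G = A G` for a constant matrix `A` exactly for straight and circular profiles. -/
theorem exists_matrix_iff {G : (Fin 2 → ℝ) → E3} (hG : IsGaussMap M.param M.domain G) :
    (∃ A : Matrix (Fin 3) (Fin 3) ℝ, ∀ q ∈ M.domain,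
        chengYauGauss M.param G q = WithLp.toLp 2 (A *ᵥ (G q).ofLp)) ↔
      M.IsFlat ∨ M.IsSpherical := by
  obtain ⟨ε, hε2, hε⟩ := exists_sign_gaussMap hG
  constructor
  · rintro ⟨A, hA⟩
    set L : E3 →ₗ[ℝ] E3 := Matrix.toLpLin 2 2 A with hL
    have hA' : ∀ s ∈ M.interval, ∀ t, M.radialCoeff s • M.radial t + M.axialCoeff s • M.frame 2
        = ε • (-deriv M.z s • L (M.radial t) + deriv M.x s • L (M.frame 2)) := by
      intro s hs t
      have hq : (![s, t] : Fin 2 → ℝ) ∈ M.domain := hs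
      have h1 := hA _ hq
      rw [chengYauGauss_param hε2 hε hq, hε _ hq] at h1
      have h2 : WithLp.toLp 2 (A *ᵥ (ε • M.unitNormal ![s, t]).ofLp)
          = L (ε • M.unitNormal ![s, t]) := rfl
      rw [h2] at h1
      simpa [unitNormal] using h1
    have hr0 : M.radial 0 = M.frame 0 := by simp [radial]
    have hrπ : M.radial Real.pi = -M.frame 0 := by simp [radial]
    refine isFlat_or_isSpherical_of_coeff (l := ε * inner ℝ (M.frame 0) (L (M.frame 0)))
      (μ := ε * inner ℝ (M.frame 2) (L (M.frame 2))) fun s hs => ?_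
    -- Passing from t = 0 to t = π reverses the radial direction; half the difference and half the
    -- sum isolate the diagonal entries of A.
    have e0 := hA' s hs 0
    have eπ := hA' s hs Real.pi
    rw [hr0] at e0
    rw [hrπ, map_neg] at eπ
    have f0 := congrArg (inner ℝ (M.frame 0)) e0
    have fπ := congrArg (inner ℝ (M.frame 0)) eπ
    have g0 := congrArg (inner ℝ (M.frame 2)) e0
    have gπ := congrArg (inner ℝ (M.frame 2)) eπ
    simp only [inner_add_right, real_inner_smul_right, inner_neg_right, inner_frame] at f0 fπ g0 gπ
    norm_num at f0 fπ g0 gπ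
    constructor
    · linear_combination (f0 - fπ) / 2
    · linear_combination (g0 + gπ) / 2
  · rintro (h | h)
    · refine ⟨0, fun q hq => ?_⟩
      obtain ⟨h1, h2⟩ := h.coeff_eq_zero hq
      rw [chengYauGauss_param hε2 hε hq, h1, h2]
      simp
    · obtain ⟨l, h⟩ := h.exists_coeff
      refine ⟨(ε * l) • 1, fun q hq => ?_⟩
      obtain ⟨h1, h2⟩ := h _ hq
      rw [chengYauGauss_param hε2 hε hq, h1, h2, hε q hq]
      have : WithLp.toLp 2 (((ε * l) • (1 : Matrix (Fin 3) (Fin 3) ℝ)) *ᵥ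
          (ε • M.unitNormal q).ofLp) = (ε ^ 2 * l) • M.unitNormal q := by
        rw [Matrix.smul_mulVec, Matrix.one_mulVec]
        ext i
        simp
        ring
      rw [this, hε2, unitNormal]
      module

end SurfaceOfRevolution

/-! ### Cartesian description of the surface and polynomials on its parallels -/

theorem isOpen_image_of_hasDerivAt_ne_zero {f : ℝ → ℝ} {I : Set ℝ} (hI : IsOpen I)
    (hf : ContDiffOn ℝ ∞ f I) (hne : ∀ s ∈ I, deriv f s ≠ 0) : IsOpen (f '' I) := by
  rw [isOpen_iff_mem_nhds]
  rintro _ ⟨s, hs, rfl⟩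
  have h : HasStrictDerivAt f (deriv f s) s :=
    (hf.contDiffAt (hI.mem_nhds hs)).hasStrictDerivAt (by simp)
  rw [← h.map_nhds_eq (hne s hs)]
  exact image_mem_map (hI.mem_nhds hs)

namespace SurfaceOfRevolution

variable {M : SurfaceOfRevolution} {s : ℝ}

variable (M) in
/-- The `i`-th Cartesian coordinate in the coordinate system of `M`. -/
def coord (i : Fin 3) (y : E3) : ℝ := inner ℝ (M.frame i) (y - M.origin)

variable (M) in
theorem continuous_coord (i : Fin 3) : Continuous (M.coord i) := by
  unfold coord; fun_prop

theorem inner_eq_sum (v w : E3) :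
    inner ℝ v w = inner ℝ (M.frame 0) v * inner ℝ (M.frame 0) w
      + inner ℝ (M.frame 1) v * inner ℝ (M.frame 1) w
      + inner ℝ (M.frame 2) v * inner ℝ (M.frame 2) w := by
  rw [← M.frame.sum_inner_mul_inner v w, Fin.sum_univ_three]
  simp only [real_inner_comm]

theorem norm_sq_eq_sum (v : E3) :
    ‖v‖ ^ 2 = inner ℝ (M.frame 0) v ^ 2 + inner ℝ (M.frame 1) v ^ 2
      + inner ℝ (M.frame 2) v ^ 2 := by
  rw [← real_inner_self_eq_norm_sq, M.inner_eq_sum v v]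
  ring

theorem inner_frame_sub (i : Fin 3) (y a : E3) :
    inner ℝ (M.frame i) (y - a) = M.coord i y - M.coord i a := by
  simp only [coord, inner_sub_right]
  ring

theorem exists_cos_sin {a b r : ℝ} (hr : 0 < r) (h : a ^ 2 + b ^ 2 = r ^ 2) :
    ∃ t, a = r * Real.cos t ∧ b = r * Real.sin t := by
  have hn : ‖(⟨a, b⟩ : ℂ)‖ = r := by
    rw [← sq_eq_sq₀ (norm_nonneg _) hr.le, ← h, Complex.sq_norm, Complex.normSq_apply]
    ring
  refine ⟨Complex.arg ⟨a, b⟩, ?_, ?_⟩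
  · rw [← hn, Complex.norm_mul_cos_arg]
  · rw [← hn, Complex.norm_mul_sin_arg]

theorem mem_carrier_iff {y : E3} :
    y ∈ M.carrier ↔ ∃ s ∈ M.interval,
      M.coord 0 y ^ 2 + M.coord 1 y ^ 2 = M.x s ^ 2 ∧ M.coord 2 y = M.z s := by
  constructor
  · rintro ⟨q, hq, rfl⟩
    refine ⟨q 0, hq, ?_⟩
    have e : M.param q - M.origin = (M.x (q 0) * Real.cos (q 1)) • M.frame 0
        + (M.x (q 0) * Real.sin (q 1)) • M.frame 1 + M.z (q 0) • M.frame 2 := by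
      rw [param]; abel
    simp only [coord, e, inner_add_right, real_inner_smul_right, inner_frame]
    simp only [Fin.reduceEq, if_true, if_false]
    refine ⟨?_, by ring⟩
    linear_combination M.x (q 0) ^ 2 * Real.cos_sq_add_sin_sq (q 1)
  · rintro ⟨s, hs, h1, h2⟩
    obtain ⟨t, h3, h4⟩ := exists_cos_sin (M.x_pos s hs) h1
    refine ⟨![s, t], hs, ?_⟩
    have e : y = M.origin + (M.coord 0 y • M.frame 0 + M.coord 1 y • M.frame 1
        + M.coord 2 y • M.frame 2) := by
      have := M.frame.sum_repr' (y - M.origin)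
      rw [Fin.sum_univ_three] at this
      simp only [coord]
      rw [this]; abel
    rw [e, h2, h3, h4]
    simp [param, add_assoc]

/-- A point of the surface over the parameter `s` in direction `(a, b)`. -/
theorem exists_mem_carrier (hs : s ∈ M.interval) {a b : ℝ} (hab : a ^ 2 + b ^ 2 = 1) :
    ∃ y ∈ M.carrier, M.coord 0 y = M.x s * a ∧ M.coord 1 y = M.x s * b ∧ M.coord 2 y = M.z s := by
  set y := M.origin + ((M.x s * a) • M.frame 0 + (M.x s * b) • M.frame 1 + M.z s • M.frame 2)
    with hy
  have h : M.coord 0 y = M.x s * a ∧ M.coord 1 y = M.x s * b ∧ M.coord 2 y = M.z s := by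
    simp only [coord, hy, add_sub_cancel_left, inner_add_right, real_inner_smul_right, inner_frame]
    simp
  refine ⟨y, mem_carrier_iff.2 ⟨s, hs, ?_, h.2.2⟩, h⟩
  rw [h.1, h.2.1]
  linear_combination M.x s ^ 2 * hab

/-- A quadratic polynomial that vanishes on the unit circle. -/
theorem coeff_eq_zero_of_vanish_on_circle {A B C D E F : ℝ}
    (h : ∀ a b : ℝ, a ^ 2 + b ^ 2 = 1 →
      A * a ^ 2 + B * (a * b) + C * b ^ 2 + D * a + E * b + F = 0) :
    A = C ∧ B = 0 ∧ D = 0 ∧ E = 0 ∧ A + F = 0 := by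
  have h1 := h 1 0 (by norm_num)
  have h2 := h (-1) 0 (by norm_num)
  have h3 := h 0 1 (by norm_num)
  have h4 := h 0 (-1) (by norm_num)
  -- The product a b vanishes at the other four points, so one more point is needed to detect B.
  have h5 := h (3 / 5) (4 / 5) (by norm_num)
  norm_num at h1 h2 h3 h4 h5
  refine ⟨?_, ?_, ?_, ?_, ?_⟩ <;> linarith

theorem eq_zero_of_sq_eq_of_mul_eq {a b : ℝ} (h1 : a ^ 2 = b ^ 2) (h2 : a * b = 0) :
    a = 0 ∧ b = 0 := by
  rcases mul_eq_zero.1 h2 with h | h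
  · subst h; simpa [eq_comm] using h1
  · subst h; simpa using h1

/-! ### Profiles of surfaces contained in a model surface -/

theorem isFlat_of_deriv_x_sq_const {e : ℝ} (he : e ≠ 0)
    (h : ∀ s ∈ M.interval, deriv M.x s ^ 2 = e) : M.IsFlat := by
  intro s hs
  have h1 := ((M.hasDerivAt_deriv_x hs).fun_pow 2).unique_of_eventuallyEq
    (hasDerivAt_const s e) (by
      filter_upwards [M.isOpen_interval.mem_nhds hs] with q hq using h q hq)
  have h0 : deriv M.x s ≠ 0 := by
    intro h0
    exact he (by rw [← h s hs, h0]; ring)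
  simpa [h0] using h1

/-- On each parallel the plane equation is linear in (cos t, sin t), so the normal is parallel to
the axis. Then z is constant and x'² = 1. -/
theorem isFlat_of_subset_plane {P : Set E3} (hP : IsPlane P) (h : M.carrier ⊆ P) : M.IsFlat := by
  obtain ⟨d, c, hd, rfl⟩ := hP
  set d0 := (inner ℝ (M.frame 0) d : ℝ) with hd0
  set d1 := (inner ℝ (M.frame 1) d : ℝ) with hd1
  set d2 := (inner ℝ (M.frame 2) d : ℝ) with hd2
  have key : ∀ s ∈ M.interval, M.x s * d0 = 0 ∧ M.x s * d1 = 0 ∧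
      M.z s * d2 + inner ℝ M.origin d - c = 0 := by
    intro s hs
    have := coeff_eq_zero_of_vanish_on_circle (A := 0) (B := 0) (C := 0) (D := M.x s * d0)
      (E := M.x s * d1) (F := M.z s * d2 + inner ℝ M.origin d - c) fun a b hab => by
        obtain ⟨y, hy, h0, h1, h2⟩ := M.exists_mem_carrier hs hab
        have hyP : inner ℝ y d = c := h hy
        have e : inner ℝ y d = inner ℝ (y - M.origin) d + inner ℝ M.origin d := by
          rw [← inner_add_left, sub_add_cancel]
        have h0' : inner ℝ (M.frame 0) (y - M.origin) = M.x s * a := h0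
        have h1' : inner ℝ (M.frame 1) (y - M.origin) = M.x s * b := h1
        have h2' : inner ℝ (M.frame 2) (y - M.origin) = M.z s := h2
        rw [M.inner_eq_sum (y - M.origin), h0', h1', h2', ← hd0, ← hd1, ← hd2] at e
        linear_combination hyP - e
    simpa using this.2.2
  obtain ⟨s₀, hs₀⟩ := M.isConnected_interval.nonempty
  have hx₀ := (M.x_pos s₀ hs₀).ne'
  have z0 : d0 = 0 := by simpa [hx₀] using (key s₀ hs₀).1
  have z1 : d1 = 0 := by simpa [hx₀] using (key s₀ hs₀).2.1
  have hn := M.norm_sq_eq_sum d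
  rw [hd, ← hd0, ← hd1, ← hd2, z0, z1] at hn
  have z2 : d2 ≠ 0 := by rintro h; simp [h] at hn
  refine isFlat_of_deriv_x_sq_const one_ne_zero fun s hs => ?_
  have hz : deriv M.z s * d2 = 0 :=
    ((M.hasDerivAt_z hs).mul_const d2).unique_of_eventuallyEq
      (hasDerivAt_const s (c - inner ℝ M.origin d)) (by
        filter_upwards [M.isOpen_interval.mem_nhds hs] with q hq
        linear_combination (key q hq).2.2)
  have hz' : deriv M.z s = 0 := (mul_eq_zero.1 hz).resolve_right z2
  have := M.unit_speed s hs
  rw [hz'] at this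
  linear_combination this

/-- If the surface lies on a quadric `⟨y - a, d⟩² = m ‖y - a‖² + r` with
`m ≠ 0`, then its axis is that of the quadric. -/
theorem axis_of_subset_quadric {a d : E3} {m n r : ℝ} (hm : m ≠ 0) (hn : n ≠ 0) (hd : ‖d‖ = 1)
    (h : ∀ y ∈ M.carrier, n * inner ℝ (y - a) d ^ 2 = m * ‖y - a‖ ^ 2 + r) :
    inner ℝ (M.frame 0) d = (0 : ℝ) ∧ inner ℝ (M.frame 1) d = (0 : ℝ) ∧
      (inner ℝ (M.frame 2) d : ℝ) ^ 2 = 1 ∧ M.coord 0 a = 0 ∧ M.coord 1 a = 0 ∧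
      ∀ s ∈ M.interval, n * (M.z s - M.coord 2 a) ^ 2
        = m * (M.x s ^ 2 + (M.z s - M.coord 2 a) ^ 2) + r := by
  set d0 := (inner ℝ (M.frame 0) d : ℝ) with hd0
  set d1 := (inner ℝ (M.frame 1) d : ℝ) with hd1
  set d2 := (inner ℝ (M.frame 2) d : ℝ) with hd2
  set a0 := M.coord 0 a
  set a1 := M.coord 1 a
  set a2 := M.coord 2 a
  have hq : ∀ s ∈ M.interval, ∀ e f : ℝ, e ^ 2 + f ^ 2 = 1 →
      n * ((M.x s * e - a0) * d0 + (M.x s * f - a1) * d1 + (M.z s - a2) * d2) ^ 2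
        = m * ((M.x s * e - a0) ^ 2 + (M.x s * f - a1) ^ 2 + (M.z s - a2) ^ 2) + r := by
    intro s hs e f hef
    obtain ⟨y, hy, h0, h1, h2⟩ := M.exists_mem_carrier hs hef
    have := h y hy
    rwa [M.inner_eq_sum (y - a), M.norm_sq_eq_sum (y - a), inner_frame_sub, inner_frame_sub,
      inner_frame_sub, h0, h1, h2] at this
  obtain ⟨s₀, hs₀⟩ := M.isConnected_interval.nonempty
  have hx₀ := (M.x_pos s₀ hs₀).ne'
  have key : ∀ s ∈ M.interval, _ := fun s hs => coeff_eq_zero_of_vanish_on_circle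
    (A := n * M.x s ^ 2 * d0 ^ 2) (B := 2 * n * M.x s ^ 2 * (d0 * d1))
    (C := n * M.x s ^ 2 * d1 ^ 2)
    (D := 2 * M.x s * (n * d0 * (-a0 * d0 - a1 * d1 + (M.z s - a2) * d2) + m * a0))
    (E := 2 * M.x s * (n * d1 * (-a0 * d0 - a1 * d1 + (M.z s - a2) * d2) + m * a1))
    (F := n * (-a0 * d0 - a1 * d1 + (M.z s - a2) * d2) ^ 2
      - m * (M.x s ^ 2 + a0 ^ 2 + a1 ^ 2 + (M.z s - a2) ^ 2) - r) fun e f hef => by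
        linear_combination hq s hs e f hef + m * M.x s ^ 2 * hef
  obtain ⟨k1, k2, k3, k4, -⟩ := key s₀ hs₀
  have hnx : n * M.x s₀ ^ 2 ≠ 0 := mul_ne_zero hn (pow_ne_zero 2 hx₀)
  -- The quadratic coefficients make d parallel to the axis of rotation; the linear ones then put a
  -- on it, since m ≠ 0.
  obtain ⟨z0, z1⟩ := eq_zero_of_sq_eq_of_mul_eq (mul_left_cancel₀ hnx k1)
    (mul_left_cancel₀ hnx (by linear_combination k2 / 2))
  rw [z0] at k3
  rw [z1] at k4
  have za0 : a0 = 0 := by simpa [hx₀, hm] using k3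
  have za1 : a1 = 0 := by simpa [hx₀, hm] using k4
  have hnn := M.norm_sq_eq_sum d
  rw [hd, ← hd0, ← hd1, ← hd2, z0, z1] at hnn
  have hd2' : d2 ^ 2 = 1 := by linear_combination -hnn
  refine ⟨z0, z1, hd2', za0, za1, fun s hs => ?_⟩
  have k5 := (key s hs).2.2.2.2
  rw [z0, z1, za0, za1] at k5
  linear_combination k5 - n * (M.z s - a2) ^ 2 * hd2'

/-- Squaring the cone equation gives a quadric. Once the axes agree, differentiating sin²α (z - a₂)²
= cos²α x² and using unit speed yields x'² = sin²α. -/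
theorem isFlat_of_subset_cone {P : Set E3} (hP : IsRightCircularCone P) (h : M.carrier ⊆ P) :
    M.IsFlat := by
  obtain ⟨a, d, α, hd, hα0, hα1, rfl⟩ := hP
  have hcos : 0 < Real.cos α := Real.cos_pos_of_mem_Ioo ⟨by linarith, hα1⟩
  have hsin : 0 < Real.sin α := Real.sin_pos_of_pos_of_lt_pi hα0 (by linarith)
  obtain ⟨-, -, -, -, -, hz⟩ := M.axis_of_subset_quadric (m := Real.cos α ^ 2) (n := 1) (r := 0)
    (pow_ne_zero 2 hcos.ne') one_ne_zero hd (a := a) fun y hy => by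
      have hyP : inner ℝ (y - a) d = ‖y - a‖ * Real.cos α := h hy
      rw [hyP]; ring
  have hcs := Real.cos_sq_add_sin_sq α
  refine isFlat_of_deriv_x_sq_const (pow_ne_zero 2 hsin.ne') fun s hs => ?_
  have hx := (M.x_pos s hs).ne'
  have hz' : ∀ s ∈ M.interval, Real.sin α ^ 2 * (M.z s - M.coord 2 a) ^ 2
      = Real.cos α ^ 2 * M.x s ^ 2 := by
    intro s hs
    linear_combination hz s hs + (M.z s - M.coord 2 a) ^ 2 * hcs
  have hd1 := ((((M.hasDerivAt_z hs).sub_const (M.coord 2 a)).fun_pow 2).const_mul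
    (Real.sin α ^ 2)).unique_of_eventuallyEq
      (((M.hasDerivAt_x hs).fun_pow 2).const_mul (Real.cos α ^ 2)) (by
        filter_upwards [M.isOpen_interval.mem_nhds hs] with q hq using hz' q hq)
  simp at hd1
  have e1 : Real.sin α ^ 2 * (M.z s - M.coord 2 a) * deriv M.z s
      = Real.cos α ^ 2 * M.x s * deriv M.x s := by linear_combination hd1 / 2
  have e2 : (Real.cos α ^ 2 * M.x s ^ 2) * (Real.sin α ^ 2 * deriv M.z s ^ 2)
      = (Real.cos α ^ 2 * M.x s ^ 2) * (Real.cos α ^ 2 * deriv M.x s ^ 2) := by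
    linear_combination (Real.sin α ^ 2 * (M.z s - M.coord 2 a) * deriv M.z s
      + Real.cos α ^ 2 * M.x s * deriv M.x s) * e1
      - (Real.sin α ^ 2 * deriv M.z s ^ 2) * hz' s hs
  have e3 := mul_left_cancel₀ (mul_ne_zero (pow_ne_zero 2 hcos.ne') (pow_ne_zero 2 hx)) e2
  linear_combination -e3 + Real.sin α ^ 2 * M.unit_speed s hs - deriv M.x s ^ 2 * hcs

theorem isFlat_of_subset_cylinder {P : Set E3} (hP : IsCircularCylinder P) (h : M.carrier ⊆ P) :
    M.IsFlat := by
  obtain ⟨a, d, r, hd, hr, rfl⟩ := hP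
  obtain ⟨-, -, -, -, -, hx⟩ := M.axis_of_subset_quadric (m := 1) (n := 1) (r := -r ^ 2)
    one_ne_zero one_ne_zero hd (a := a) fun y hy => by
      have hyP : ‖(y - a) - inner ℝ (y - a) d • d‖ = r := h hy
      have e := norm_sub_sq_real (y - a) (inner ℝ (y - a) d • d)
      rw [hyP, norm_smul, hd, real_inner_smul_right, mul_one, Real.norm_eq_abs, sq_abs] at e
      linear_combination e
  have hx0 : ∀ s ∈ M.interval, deriv M.x s = 0 := by
    intro s hs
    have h1 := ((M.hasDerivAt_x hs).fun_pow 2).unique_of_eventuallyEq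
      (hasDerivAt_const s (r ^ 2)) (by
        filter_upwards [M.isOpen_interval.mem_nhds hs] with q hq
        linear_combination -hx q hq)
    simpa [(M.x_pos s hs).ne'] using h1
  intro s hs
  exact (M.hasDerivAt_deriv_x hs).unique_of_eventuallyEq (hasDerivAt_const s (0 : ℝ)) (by
    filter_upwards [M.isOpen_interval.mem_nhds hs] with q hq using hx0 q hq)

theorem isSpherical_of_subset_sphere {P : Set E3} (hP : IsRoundSphere P) (h : M.carrier ⊆ P) :
    M.IsSpherical := by
  obtain ⟨c, r, hr, rfl⟩ := hP
  set z₀ := M.coord 2 c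
  have key : ∀ s ∈ M.interval, M.x s ^ 2 + (M.z s - z₀) ^ 2 = r ^ 2 := by
    intro s hs
    have hq : ∀ e f : ℝ, e ^ 2 + f ^ 2 = 1 →
        (M.x s * e - M.coord 0 c) ^ 2 + (M.x s * f - M.coord 1 c) ^ 2 + (M.z s - z₀) ^ 2
          = r ^ 2 := by
      intro e f hef
      obtain ⟨y, hy, h0, h1, h2⟩ := M.exists_mem_carrier hs hef
      have hyP : ‖y - c‖ = r := mem_sphere_iff_norm.1 (h hy)
      rw [← hyP, M.norm_sq_eq_sum (y - c), inner_frame_sub, inner_frame_sub, inner_frame_sub,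
        h0, h1, h2]
    have hx := (M.x_pos s hs).ne'
    obtain ⟨-, -, k3, k4, k5⟩ := coeff_eq_zero_of_vanish_on_circle (A := 0) (B := 0) (C := 0)
      (D := -2 * M.x s * M.coord 0 c) (E := -2 * M.x s * M.coord 1 c)
      (F := M.x s ^ 2 + M.coord 0 c ^ 2 + M.coord 1 c ^ 2 + (M.z s - z₀) ^ 2 - r ^ 2)
      fun e f hef => by linear_combination hq e f hef - M.x s ^ 2 * hef
    have c0 : M.coord 0 c = 0 := by simpa [hx] using k3
    have c1 : M.coord 1 c = 0 := by simpa [hx] using k4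
    rw [c0, c1] at k5
    linear_combination k5
  have hperp : ∀ s ∈ M.interval, M.x s * deriv M.x s + (M.z s - z₀) * deriv M.z s = 0 := by
    intro s hs
    have h1 := (((M.hasDerivAt_x hs).fun_pow 2).fun_add
      (((M.hasDerivAt_z hs).sub_const z₀).fun_pow 2)).unique_of_eventuallyEq
      (hasDerivAt_const s (r ^ 2)) (by
        filter_upwards [M.isOpen_interval.mem_nhds hs] with q hq using key q hq)
    simp at h1
    linear_combination h1 / 2
  -- The position vector from the centre is orthogonal to the velocity by `hperp`, so it is
  -- determined by its normal component p, which is constant.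
  obtain ⟨p, hp⟩ := M.isConnected_interval.isPreconnected.exists_eq_const_of_hasDerivAt_zero
    M.isOpen_interval (f := fun s => M.x s * deriv M.z s - (M.z s - z₀) * deriv M.x s)
    fun s hs => (((M.hasDerivAt_x hs).fun_mul (M.hasDerivAt_deriv_z hs)).fun_sub
      (((M.hasDerivAt_z hs).sub_const z₀).fun_mul (M.hasDerivAt_deriv_x hs))).congr_deriv (by
        rw [deriv_deriv_x hs, deriv_deriv_z hs]
        linear_combination M.profileCurv s * hperp s hs)
  have hxp : ∀ s ∈ M.interval, M.x s = p * deriv M.z s := by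
    intro s hs
    linear_combination -M.x s * M.unit_speed s hs + deriv M.z s * hp s hs
      + deriv M.x s * hperp s hs
  refine ⟨p, z₀, ?_, fun s hs => ⟨hxp s hs, ?_⟩⟩
  · rintro rfl
    obtain ⟨s, hs⟩ := M.isConnected_interval.nonempty
    exact (M.x_pos s hs).ne' (by rw [hxp s hs, zero_mul])
  · linear_combination -(M.z s - z₀) * M.unit_speed s hs - deriv M.x s * hp s hs
      + deriv M.z s * hperp s hs

/-! ### Straight and circular profiles give open parts of model surfaces -/

/-- If a set is cut out of the surface by its height, the surface is an open part of it. -/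
theorem isOpenPart_of_height {P : Set E3} (hz : ∀ s ∈ M.interval, deriv M.z s ≠ 0)
    (h : ∀ y, ∀ s ∈ M.interval, M.coord 2 y = M.z s →
      (y ∈ P ↔ M.coord 0 y ^ 2 + M.coord 1 y ^ 2 = M.x s ^ 2)) : IsOpenPart M.carrier P := by
  refine ⟨M.coord 2 ⁻¹' (M.z '' M.interval),
    (isOpen_image_of_hasDerivAt_ne_zero M.isOpen_interval M.smooth_z hz).preimage
      (M.continuous_coord 2), ?_⟩
  ext y
  rw [mem_carrier_iff]
  constructor
  · rintro ⟨s, hs, h1, h2⟩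
    exact ⟨(h y s hs h2).2 h1, s, hs, h2.symm⟩
  · rintro ⟨hy, s, hs, h2⟩
    exact ⟨s, hs, (h y s hs h2.symm).1 hy, h2.symm⟩

theorem inner_frame_two_sub_origin_add (y : E3) (e : ℝ) :
    inner ℝ (M.frame 2) (y - (M.origin + e • M.frame 2)) = M.coord 2 y - e := by
  rw [← sub_sub, inner_sub_right, real_inner_smul_right, inner_frame]
  simp [coord]

theorem norm_sq_sub_origin_add (y : E3) (e : ℝ) :
    ‖y - (M.origin + e • M.frame 2)‖ ^ 2
      = M.coord 0 y ^ 2 + M.coord 1 y ^ 2 + (M.coord 2 y - e) ^ 2 := by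
  rw [M.norm_sq_eq_sum, inner_frame_two_sub_origin_add]
  simp only [← sub_sub, inner_sub_right _ _ (e • M.frame 2), real_inner_smul_right, inner_frame]
  simp [coord]

theorem IsSpherical.isOpenPart (h : M.IsSpherical) :
    ∃ P : Set E3, IsRoundSphere P ∧ IsOpenPart M.carrier P := by
  obtain ⟨p, z₀, hp, h⟩ := h
  refine ⟨_, ⟨M.origin + z₀ • M.frame 2, |p|, abs_pos.2 hp, rfl⟩, isOpenPart_of_height ?_ ?_⟩
  · intro s hs h0
    exact (M.x_pos s hs).ne' (by rw [(h s hs).1, h0, mul_zero])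
  · intro y s hs hy
    obtain ⟨h1, h2⟩ := h s hs
    have hu := M.unit_speed s hs
    rw [mem_sphere_iff_norm, ← sq_eq_sq₀ (norm_nonneg _) (abs_nonneg p), sq_abs,
      norm_sq_sub_origin_add, hy, h2, h1]
    constructor
    · intro e; linear_combination e - p ^ 2 * hu
    · intro e; linear_combination e + p ^ 2 * hu

theorem norm_frame (i : Fin 3) : ‖M.frame i‖ = 1 := M.frame.norm_eq_one i

theorem IsFlat.isOpenPart (h : M.IsFlat) :
    ∃ P : Set E3, (IsPlane P ∨ IsRightCircularCone P ∨ IsCircularCylinder P) ∧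
      IsOpenPart M.carrier P := by
  have hI := M.isOpen_interval
  have hconn := M.isConnected_interval.isPreconnected
  obtain ⟨s₀, hs₀⟩ := M.isConnected_interval.nonempty
  obtain ⟨a, b, hab, h⟩ := h.exists_velocity
  rcases eq_or_ne b 0 with rfl | hb
  · obtain ⟨e, he⟩ := hconn.exists_eq_const_of_hasDerivAt_zero hI
      fun s hs => (M.hasDerivAt_z hs).congr_deriv (h s hs).2
    have ha : a ≠ 0 := by rintro rfl; norm_num at hab
    refine ⟨_, Or.inl ⟨M.frame 2, inner ℝ M.origin (M.frame 2) + e, norm_frame 2, rfl⟩,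
      -- In a horizontal plane the height is constant, so the open set is cut out by the distance to
      -- the axis.
      {y | √(M.coord 0 y ^ 2 + M.coord 1 y ^ 2) ∈ M.x '' M.interval}, ?_, ?_⟩
    · refine (isOpen_image_of_hasDerivAt_ne_zero hI M.smooth_x
        fun s hs => by rwa [(h s hs).1]).preimage ?_
      exact (((M.continuous_coord 0).pow 2).add ((M.continuous_coord 1).pow 2)).sqrt
    · have hy2 : ∀ y : E3, inner ℝ y (M.frame 2) = inner ℝ M.origin (M.frame 2) + e ↔
          M.coord 2 y = e := by
        intro y
        rw [coord, inner_sub_right, real_inner_comm, real_inner_comm (M.frame 2) M.origin,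
          sub_eq_iff_eq_add, add_comm e]
      ext y
      rw [mem_carrier_iff]
      constructor
      · rintro ⟨s, hs, h1, h2⟩
        refine ⟨(hy2 y).2 (by rw [h2, he s hs]), s, hs, ?_⟩
        rw [h1, Real.sqrt_sq (M.x_pos s hs).le]
      · rintro ⟨hy, s, hs, h1⟩
        refine ⟨s, hs, ?_, by rw [(hy2 y).1 hy, he s hs]⟩
        rw [h1, Real.sq_sqrt (by positivity)]
  have hz : ∀ s ∈ M.interval, deriv M.z s ≠ 0 := fun s hs => by rwa [(h s hs).2]
  rcases eq_or_ne a 0 with rfl | ha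
  · obtain ⟨r, hr⟩ := hconn.exists_eq_const_of_hasDerivAt_zero hI
      fun s hs => (M.hasDerivAt_x hs).congr_deriv (h s hs).1
    have hr0 : 0 < r := by rw [← hr s₀ hs₀]; exact M.x_pos s₀ hs₀
    refine ⟨_, Or.inr (Or.inr ⟨M.origin, M.frame 2, r, norm_frame 2, hr0, rfl⟩),
      isOpenPart_of_height hz ?_⟩
    intro y s hs hy
    have e : ‖(y - M.origin) - inner ℝ (y - M.origin) (M.frame 2) • M.frame 2‖ ^ 2
        = M.coord 0 y ^ 2 + M.coord 1 y ^ 2 := by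
      rw [M.norm_sq_eq_sum]
      simp only [inner_sub_right _ (y - M.origin), real_inner_smul_right, inner_frame,
        real_inner_comm _ (y - M.origin)]
      simp [coord]
    rw [Set.mem_ofPred_eq, ← sq_eq_sq₀ (norm_nonneg _) hr0.le, e, hr s hs]
  · obtain ⟨e, he⟩ := hconn.exists_eq_const_of_hasDerivAt_zero hI
      (f := fun s => M.z s - b / a * M.x s) fun s hs =>
        ((M.hasDerivAt_z hs).fun_sub ((M.hasDerivAt_x hs).const_mul (b / a))).congr_deriv (by
          rw [(h s hs).1, (h s hs).2]; field_simp; ring)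
    have hb1 : |b| < 1 := by
      rw [← sq_lt_one_iff_abs_lt_one]
      have : 0 < a ^ 2 := by positivity
      linarith
    have hb0 : 0 < |b| := abs_pos.2 hb
    have hcos : Real.cos (Real.arccos |b|) = |b| := Real.cos_arccos (by linarith) hb1.le
    have hba : b / a ≠ 0 := div_ne_zero hb ha
    -- A cone here has one nappe. The sign σ orients its axis so that the surface, where x > 0, lies
    -- on it; the half-angle is `arccos |b|` because the generator has unit velocity (a, b).
    obtain ⟨σ, hσ2, hσab⟩ : ∃ σ : ℝ, σ ^ 2 = 1 ∧ 0 < σ * (b / a) := by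
      rcases lt_or_gt_of_ne hba with h | h
      · exact ⟨-1, by norm_num, by linarith⟩
      · exact ⟨1, by norm_num, by linarith⟩
    refine ⟨_, Or.inr (Or.inl ⟨M.origin + e • M.frame 2, σ • M.frame 2, Real.arccos |b|, ?_,
      Real.arccos_pos.2 hb1, Real.arccos_lt_pi_div_two.2 hb0, rfl⟩), isOpenPart_of_height hz ?_⟩
    · rw [norm_smul, norm_frame, mul_one, Real.norm_eq_abs, ← sq_eq_sq₀ (abs_nonneg _) zero_le_one,
        sq_abs, hσ2, one_pow]
    · intro y s hs hy
      have hx := M.x_pos s hs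
      have hze : M.z s - e = b / a * M.x s := by linear_combination he s hs
      rw [Set.mem_ofPred_eq, hcos, real_inner_smul_right, real_inner_comm,
        inner_frame_two_sub_origin_add, hy, hze,
        ← sq_eq_sq₀ (by rw [← mul_assoc]; positivity) (by positivity), mul_pow, mul_pow ‖_‖, hσ2,
        sq_abs, norm_sq_sub_origin_add, hy, hze]
      have hb2 : b ^ 2 ≠ 0 := pow_ne_zero 2 hb
      have hca : (b / a * M.x s) ^ 2 * a ^ 2 = b ^ 2 * M.x s ^ 2 := by field_simp
      constructor
      · intro e1
        refine mul_left_cancel₀ hb2 ?_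
        linear_combination -e1 + hca - (b / a * M.x s) ^ 2 * hab
      · intro e1
        linear_combination -b ^ 2 * e1 + hca - (b / a * M.x s) ^ 2 * hab

end SurfaceOfRevolution

end

/-- A surface of revolution `M` with Gauss map `G` satisfies `□ G = A G` for some constant 3×3
matrix `A` if and only if `M` is an open part of a plane, a right circular cone, a circular cylinder
or a sphere. -/
theorem theorem4p1 (M : SurfaceOfRevolution) (G : (Fin 2 → ℝ) → E3)
    (hG : IsGaussMap M.param M.domain G) :
    (∃ A : Matrix (Fin 3) (Fin 3) ℝ, ∀ q ∈ M.domain,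
        chengYauGauss M.param G q = WithLp.toLp 2 (A *ᵥ (G q).ofLp)) ↔
      ∃ P : Set E3,
        (IsPlane P ∨ IsRightCircularCone P ∨ IsCircularCylinder P ∨ IsRoundSphere P) ∧
          IsOpenPart M.carrier P := by
  rw [SurfaceOfRevolution.exists_matrix_iff hG]
  constructor
  · rintro (h | h)
    · obtain ⟨P, hP, hM⟩ := h.isOpenPart
      exact ⟨P, by tauto, hM⟩
    · obtain ⟨P, hP, hM⟩ := h.isOpenPart
      exact ⟨P, by tauto, hM⟩
  · rintro ⟨P, hP, O, -, hM⟩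
    have hsub : M.carrier ⊆ P := hM ▸ Set.inter_subset_left
    rcases hP with hP | hP | hP | hP
    · exact Or.inl (SurfaceOfRevolution.isFlat_of_subset_plane hP hsub)
    · exact Or.inl (SurfaceOfRevolution.isFlat_of_subset_cone hP hsub)
    · exact Or.inl (SurfaceOfRevolution.isFlat_of_subset_cylinder hP hsub)
    · exact Or.inr (SurfaceOfRevolution.isSpherical_of_subset_sphere hP hsub)
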